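/- Let $\mathcal Z=\prod_p\mathbb Z_p$ (product over all primes), a subring of the ring $\mathcal A_f$ of finite adeles, on which the positive rationals $\mathbb Q^*_+$ act by $r\cdot(a_p)_p=(ra_p)_p$. Identify $\mathcal Z$ with the Pontryagin dual of the discrete group $\mathbb Q/\mathbb Z$ through the pairing $\langle r,z\rangle=e^{2\pi i zr}$, and write $\hat f(z)$ for the value at $z\in\mathcal Z$ of the Fourier transform of $f\in C^*(\mathbb Q/\mathbb Z)$, so that $\hat\delta_r(z)=\langle r,z\rangle$. Let $\mathbb N^\times$ be the multiplicative semigroup of positive integers and let $\alpha$ be its action by endomorphisms of $C^*(\mathbb Q/\mathbb Z)$ given by $\alpha_n(\delta_r)=\frac1n\sum_{ns=r}\delta_s$. The Bost--Connes algebra is the semigroup crossed product $\mathcal C_{\mathbb Q}=C^*(\mathbb Q/\mathbb Z)\rtimes_\alpha\mathbb N^\times$, the universal $C^*$-algebra for pairs $(\pi,V)$ consisting of a unital representation $\pi$ of $C^*(\mathbb Q/\mathbb Z)$ and a representation $V$ of $\mathbb N^\times$ by isometries on the same Hilbert space such that $\pi(\alpha_n(f))=V_n\pi(f)V_n^*$;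 the representation of $\mathcal C_{\mathbb Q}$ given by such a pair is denoted $\pi\times V$. For $a\in\mathcal Z$ let $(\pi_a,V)$ be the covariant pair on $\ell^2(\{r\in\mathbb Q^*_+: ra\in\mathcal Z\})$, with canonical orthonormal basis $(e_r)$, given by $\pi_a(f)e_r=\hat f(ra)e_r$ and $V_ne_r=e_{nr}$. Suppose $a\in\mathcal Z$ and $a\neq0$. (1) The representation $\pi_a\times V$ of $\mathcal C_{\mathbb Q}$ is faithful if and only if $a$ is not a zero divisor in $\mathcal Z$; and $a$ is not a zero divisor if and only if $a_p\neq0$ for every prime $p$. (2) Let $b\in\mathcal Z$ with $b\neq0$. The representations $\pi_a\times V$ and $\pi_b\times V$ are unitarily equivalent if and only if $a$ and $b$ lie in the same $\mathbb Q^*_+$-orbit, i.e. $b=ra$ for some $r\in\mathbb Q^*_+$. -/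

import Mathlib

open scoped ENNReal

namespace BostConnes

noncomputable section

/-! ### The profinite integers and the group `ℚ/ℤ` -/

instance primesFact (p : Nat.Primes) : Fact (p : ℕ).Prime := ⟨p.2⟩

/-- The compact ring `𝒵 = ∏ₚ ℤₚ`. -/
abbrev ZHat : Type := ∀ p : Nat.Primes, ℤ_[(p : ℕ)]

/-- The discrete group `ℚ/ℤ`. -/
abbrev QZ : Type := ℚ ⧸ AddSubgroup.zmultiples (1 : ℚ)

theorem QZ.mk_eq_zero_iff (x : ℚ) : ((x : QZ) = 0) ↔ ∃ k : ℤ, (k : ℚ) = x := by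
  rw [QuotientAddGroup.eq_zero_iff, AddSubgroup.mem_zmultiples_iff]
  simp

theorem QZ.isOfFinAddOrder (r : QZ) : 0 < addOrderOf r := by
  induction r using QuotientAddGroup.induction_on with
  | H x =>
    rw [addOrderOf_pos_iff, isOfFinAddOrder_iff_nsmul_eq_zero]
    refine ⟨x.den, x.den_pos, ?_⟩
    rw [← QuotientAddGroup.mk_nsmul, QZ.mk_eq_zero_iff]
    exact ⟨x.num, by rw [nsmul_eq_mul, mul_comm, Rat.mul_den_eq_num]⟩

theorem intCast_dvd_iff (d m : ℤ) : (d : ZHat) ∣ (m : ZHat) ↔ d ∣ m := by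
  constructor
  · intro h
    by_cases hm : m = 0
    · simp [hm]
    rw [← Int.natAbs_dvd_natAbs]
    rw [Nat.dvd_iff_prime_pow_dvd_dvd]
    intro p k hp hk
    have : Fact p.Prime := ⟨hp⟩
    have h1 : (d : ℤ_[p]) ∣ (m : ℤ_[p]) := by
      obtain ⟨c, hc⟩ := h
      exact ⟨c ⟨p, hp⟩, congrFun hc ⟨p, hp⟩⟩
    have h2 : (p : ℤ_[p]) ^ k ∣ (d : ℤ_[p]) := by
      rw [PadicInt.pow_p_dvd_int_iff]
      rw [← Int.natCast_dvd] at hk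
      exact_mod_cast hk
    have h3 := (PadicInt.pow_p_dvd_int_iff k m).1 (h2.trans h1)
    rw [← Int.natCast_dvd]
    exact_mod_cast h3
  · rintro ⟨c, rfl⟩
    exact ⟨c, by push_cast; rfl⟩

theorem exists_prime_dvd_sub (p : ℕ) (hp : p.Prime) (z : ZHat) :
    ∃ m : ℤ, (p : ZHat) ∣ z - m := by
  have : Fact p.Prime := ⟨hp⟩
  obtain ⟨m, -, hm⟩ := PadicInt.exists_mem_range (p := p) (z ⟨p, hp⟩)
  rw [PadicInt.maximalIdeal_eq_span_p, Ideal.mem_span_singleton] at hm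
  refine ⟨m, pi_dvd_iff.2 fun q => ?_⟩
  by_cases hq : q = ⟨p, hp⟩
  · subst hq
    exact hm
  · apply IsUnit.dvd
    rw [Pi.natCast_apply, PadicInt.isUnit_iff]
    have : ((p : ℕ) : ℤ_[(q : ℕ)]) = ((p : ℤ) : ℤ_[(q : ℕ)]) := by simp
    rw [this]
    refine le_antisymm (PadicInt.norm_le_one _) (not_lt.1 fun hlt => hq ?_)
    rw [PadicInt.norm_int_lt_one_iff_dvd] at hlt
    have := (Nat.prime_dvd_prime_iff_eq q.2 hp).1 (by exact_mod_cast hlt)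
    exact Subtype.ext this

/-- `ℤ` has dense image in `𝒵`: residues modulo every positive integer exist. -/
theorem exists_dvd_sub (n : ℕ) (hn : 0 < n) (z : ZHat) : ∃ m : ℤ, (n : ZHat) ∣ z - m := by
  induction n using Nat.recOnMul generalizing z with
  | zero => exact absurd hn (lt_irrefl _)
  | one => exact ⟨0, by simp⟩
  | prime p hp => exact exists_prime_dvd_sub p hp z
  | mul a b iha ihb =>
    obtain ⟨m, w, hw⟩ := iha (Nat.pos_of_mul_pos_right hn) z
    obtain ⟨j, v, hv⟩ := ihb (Nat.pos_of_mul_pos_left hn) w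
    refine ⟨m + a * j, v, ?_⟩
    push_cast
    have : w = b * v + j := by rw [← hv]; ring
    calc z - (m + a * j) = (z - m) - a * j := by ring
      _ = _ := by rw [hw, this]; ring

/-- An integer congruent to `z ∈ 𝒵` modulo the order of `r`. -/
def residue (z : ZHat) (r : QZ) : ℤ :=
  (exists_dvd_sub (addOrderOf r) (QZ.isOfFinAddOrder r) z).choose

/-- The product `z · r ∈ ℚ/ℤ` of `z ∈ 𝒵` and `r ∈ ℚ/ℤ`: it is `m r` for every integer `m` which is
congruent to `z` modulo the order of `r`. -/
def act (z : ZHat) (r : QZ) : QZ := residue z r • r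

theorem act_eq {z : ZHat} {r : QZ} {n : ℕ} {m : ℤ} (hr : n • r = 0) (hm : (n : ZHat) ∣ z - m) :
    act z r = m • r := by
  have h1 := (exists_dvd_sub (addOrderOf r) (QZ.isOfFinAddOrder r) z).choose_spec
  have h2 : ((addOrderOf r : ℕ) : ZHat) ∣ z - m :=
    (Nat.cast_dvd_cast (addOrderOf_dvd_of_nsmul_eq_zero hr)).trans hm
  have h3 : (((addOrderOf r : ℕ) : ℤ) : ZHat) ∣ ((residue z r - m : ℤ) : ZHat) := by
    have := dvd_sub h2 h1
    push_cast
    convert this using 1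
    unfold residue
    ring
  rw [intCast_dvd_iff, addOrderOf_dvd_iff_zsmul_eq_zero, sub_smul, sub_eq_zero] at h3
  exact h3

theorem act_add (z : ZHat) (r s : QZ) : act z (r + s) = act z r + act z s := by
  have hN : 0 < addOrderOf r * addOrderOf s :=
    Nat.mul_pos (QZ.isOfFinAddOrder r) (QZ.isOfFinAddOrder s)
  obtain ⟨m, hm⟩ := exists_dvd_sub _ hN z
  have hr : (addOrderOf r * addOrderOf s) • r = 0 := by
    rw [mul_comm, mul_smul, addOrderOf_nsmul_eq_zero, smul_zero]
  have hs : (addOrderOf r * addOrderOf s) • s = 0 := by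
    rw [mul_smul, addOrderOf_nsmul_eq_zero, smul_zero]
  rw [act_eq hr hm, act_eq hs hm, act_eq (by rw [smul_add, hr, hs, add_zero]) hm, smul_add]

theorem act_zero (z : ZHat) : act z 0 = 0 := smul_zero _

theorem act_natCast_mul (n : ℕ) (z : ZHat) (r : QZ) : act (n * z) r = act z (n • r) := by
  obtain ⟨m, hm⟩ := exists_dvd_sub _ (QZ.isOfFinAddOrder r) z
  have hr := addOrderOf_nsmul_eq_zero r
  have h1 : ((addOrderOf r : ℕ) : ZHat) ∣ n * z - ((n * m : ℤ) : ZHat) := by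
    push_cast
    rw [← mul_sub]
    exact hm.mul_left _
  rw [act_eq hr h1, act_eq (r := n • r) (by rw [smul_comm, hr, smul_zero]) hm, mul_comm, mul_smul,
    natCast_zsmul]

/-- The homomorphism `ℚ/ℤ → 𝕋`, `x ↦ exp (2πix)`. -/
def expQZ : QZ →+ Additive Circle :=
  QuotientAddGroup.lift (AddSubgroup.zmultiples (1 : ℚ))
    (Circle.expHom.comp ((AddMonoidHom.mulLeft (2 * Real.pi)).comp
      (Rat.castHom ℝ).toAddMonoidHom))
    (by
      rw [AddSubgroup.zmultiples_le]
      simp [AddMonoidHom.mem_ker])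

theorem expQZ_mk (x : ℚ) : expQZ (x : QZ) = Additive.ofMul (Circle.exp (2 * Real.pi * x)) := rfl

theorem expQZ_eq_zero {r : QZ} (h : expQZ r = 0) : r = 0 := by
  induction r using QuotientAddGroup.induction_on with
  | H x =>
    rw [expQZ_mk, ofMul_eq_zero, Circle.exp_eq_one] at h
    obtain ⟨k, hk⟩ := h
    rw [QZ.mk_eq_zero_iff]
    refine ⟨k, ?_⟩
    have h2 : (x : ℝ) = k := by
      have := Real.pi_pos
      apply mul_left_cancel₀ (show (2 * Real.pi) ≠ 0 by positivity)
      rw [hk]; ring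
    exact_mod_cast h2.symm

/-- The canonical pairing `⟨r, z⟩ = exp (2πi z r)`, through which `𝒵` is the Pontryagin dual of
`ℚ/ℤ`; `character z` is the character of `ℚ/ℤ` given by `z ∈ 𝒵`. -/
def character (z : ZHat) : Multiplicative QZ →* Circle where
  toFun r := (expQZ (act z r.toAdd)).toMul
  map_one' := by simp [act_zero]
  map_mul' r s := by simp [act_add]

theorem divisors_aux (n : ℕ+) (x : ℚ) :
    {s : QZ | (n : ℕ) • s = (x : QZ)} =
      ((Finset.range n).image fun k : ℕ => (((x + k) / n : ℚ) : QZ)) := by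
  have hn : ((n : ℕ) : ℚ) ≠ 0 := by exact_mod_cast n.pos.ne'
  ext s
  simp only [Set.mem_ofPred_eq, Finset.coe_image, Set.mem_image, Finset.mem_coe, Finset.mem_range]
  constructor
  · induction s using QuotientAddGroup.induction_on with
    | H y =>
      intro h
      rw [← QuotientAddGroup.mk_nsmul, ← sub_eq_zero, ← QuotientAddGroup.mk_sub,
        QZ.mk_eq_zero_iff] at h
      obtain ⟨j, hj⟩ := h
      have hn' : (0 : ℤ) < (n : ℕ) := by exact_mod_cast n.pos
      refine ⟨(j % (n : ℕ)).toNat, ?_, ?_⟩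
      · have := Int.emod_lt_of_pos j hn'
        omega
      · rw [← sub_eq_zero, ← QuotientAddGroup.mk_sub, QZ.mk_eq_zero_iff]
        refine ⟨-(j / (n : ℕ)), ?_⟩
        have h1 : (((j % (n : ℕ)).toNat : ℕ) : ℚ) = ((j % (n : ℕ) : ℤ) : ℚ) := by
          rw [← Int.cast_natCast, Int.toNat_of_nonneg (Int.emod_nonneg _ hn'.ne')]
        have h2 : ((j : ℤ) : ℚ) = ((j % (n : ℕ) : ℤ) : ℚ) + (n : ℕ) * ((j / (n : ℕ) : ℤ) : ℚ) := by
          exact_mod_cast (Int.emod_add_mul_ediv j n).symm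
        rw [h1]
        rw [nsmul_eq_mul] at hj
        field_simp
        push_cast
        linear_combination h2 - hj
  · rintro ⟨k, -, rfl⟩
    rw [← QuotientAddGroup.mk_nsmul, ← sub_eq_zero, ← QuotientAddGroup.mk_sub, QZ.mk_eq_zero_iff]
    refine ⟨k, ?_⟩
    rw [nsmul_eq_mul]
    field_simp
    push_cast
    ring

theorem finite_divisors (n : ℕ+) (r : QZ) : {s : QZ | (n : ℕ) • s = r}.Finite := by
  induction r using QuotientAddGroup.induction_on with
  | H x => exact (divisors_aux n x).symm ▸ Finset.finite_toSet _

/-- The finite set `{s ∈ ℚ/ℤ : n s = r}`. -/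
def divisors (n : ℕ+) (r : QZ) : Finset QZ := (finite_divisors n r).toFinset

@[simp] theorem mem_divisors {n : ℕ+} {r s : QZ} : s ∈ divisors n r ↔ (n : ℕ) • s = r := by
  simp [divisors]

theorem card_divisors (n : ℕ+) (r : QZ) : (divisors n r).card = n := by
  have hn : ((n : ℕ) : ℚ) ≠ 0 := by exact_mod_cast n.pos.ne'
  induction r using QuotientAddGroup.induction_on with
  | H x =>
    have h : divisors n (x : QZ) =
        (Finset.range n).image fun k : ℕ => (((x + k) / n : ℚ) : QZ) := by
      rw [← Finset.coe_inj, ← divisors_aux]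
      exact Set.Finite.coe_toFinset _
    rw [h, Finset.card_image_of_injOn, Finset.card_range]
    intro k hk l hl hkl
    simp only [Finset.coe_range, Set.mem_Iio] at hk hl
    simp only at hkl
    rw [← sub_eq_zero, ← QuotientAddGroup.mk_sub, QZ.mk_eq_zero_iff] at hkl
    obtain ⟨j, hj⟩ := hkl
    field_simp at hj
    have h1 : (j : ℤ) * (n : ℕ) = (k : ℤ) - l := by
      have : ((j * (n : ℕ) : ℤ) : ℚ) = ((k - l : ℤ) : ℚ) := by
        push_cast
        linear_combination hj
      exact_mod_cast this
    have h2 : j = 0 := by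
      by_contra h0
      have : ((n : ℕ) : ℤ) ≤ |j * (n : ℕ)| := by
        rw [abs_mul, Nat.abs_cast]
        nlinarith [Int.one_le_abs h0, n.pos]
      rw [h1] at this
      rcases abs_cases ((k : ℤ) - l) with ⟨h, _⟩ | ⟨h, _⟩ <;> omega
    subst h2
    omega

theorem divisors_nonempty (n : ℕ+) (r : QZ) : (divisors n r).Nonempty := by
  rw [← Finset.card_pos, card_divisors]
  exact n.pos

/-- Summation over the fibres `{t : n t = s}`, for `s` in `{s : m s = r}`. -/
theorem sum_divisors_mul {M : Type*} [AddCommMonoid M] (m n : ℕ+) (r : QZ) (f : QZ → M) :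
    ∑ s ∈ divisors m r, ∑ t ∈ divisors n s, f t = ∑ t ∈ divisors (m * n) r, f t := by
  rw [← Finset.sum_fiberwise_of_maps_to (s := divisors (m * n) r) (t := divisors m r)
    (g := fun t => (n : ℕ) • t)]
  · refine Finset.sum_congr rfl fun s hs => Finset.sum_congr ?_ fun _ _ => rfl
    ext t
    simp only [mem_divisors, Finset.mem_filter] at hs ⊢
    constructor
    · intro h
      refine ⟨?_, h⟩
      rw [PNat.mul_coe, mul_smul, h, hs]
    · exact fun h => h.2
  · intro t ht
    simp only [mem_divisors, PNat.mul_coe, mul_smul] at ht ⊢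
    exact ht

theorem sum_divisors_add {M : Type*} [AddCommMonoid M] (n : ℕ+) {r s t : QZ} (hs : (n : ℕ) • s = r)
    (f : QZ → M) : ∑ u ∈ divisors n t, f (s + u) = ∑ u ∈ divisors n (r + t), f u := by
  refine Finset.sum_bij' (fun u _ => s + u) (fun u _ => u - s) ?_ ?_ ?_ ?_ ?_
  · intro u hu
    simp only [mem_divisors, smul_add] at hu ⊢
    rw [hu, hs]
  · intro u hu
    simp only [mem_divisors, smul_sub] at hu ⊢
    rw [hu, hs, add_sub_cancel_left]
  · simp
  · simp
  · simp

theorem sum_divisors_neg {M : Type*} [AddCommMonoid M] (n : ℕ+) (r : QZ)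
    (f : QZ → M) : ∑ u ∈ divisors n r, f (-u) = ∑ u ∈ divisors n (-r), f u := by
  refine Finset.sum_bij' (fun u _ => -u) (fun u _ => -u) ?_ ?_ ?_ ?_ ?_ <;>
    simp +contextual [mem_divisors]

theorem sum_character_mul (n : ℕ+) (w : ZHat) (r : QZ) :
    ∑ s ∈ divisors n r, (character ((n : ℕ) * w) (.ofAdd s) : ℂ) =
      (n : ℕ) * (character w (.ofAdd r) : ℂ) := by
  have : ∀ s ∈ divisors n r, (character ((n : ℕ) * w) (.ofAdd s) : ℂ) =
      (character w (.ofAdd r) : ℂ) := by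
    intro s hs
    rw [mem_divisors] at hs
    simp only [character, MonoidHom.coe_mk, OneHom.coe_mk, toAdd_ofAdd, act_natCast_mul, hs]
  rw [Finset.sum_congr rfl this, Finset.sum_const, card_divisors, nsmul_eq_mul]

theorem sum_character_of_not_dvd (n : ℕ+) {z : ZHat} (hz : ¬ ((n : ℕ) : ZHat) ∣ z) (r : QZ) :
    ∑ s ∈ divisors n r, (character z (.ofAdd s) : ℂ) = 0 := by
  have hn : ((n : ℕ) : ℚ) ≠ 0 := by exact_mod_cast n.pos.ne'
  let t : QZ := ((1 / (n : ℕ) : ℚ) : QZ)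
  have ht : (n : ℕ) • t = 0 := by
    rw [← QuotientAddGroup.mk_nsmul, QZ.mk_eq_zero_iff]
    exact ⟨1, by rw [nsmul_eq_mul]; field_simp; simp⟩
  have hne : (character z (.ofAdd t) : ℂ) ≠ 1 := by
    intro h
    obtain ⟨m, hm⟩ := exists_dvd_sub n n.pos z
    have h1 : character z (.ofAdd t) = 1 := Circle.coe_eq_one.1 h
    have h2 : act z t = 0 := expQZ_eq_zero (by
      simpa [character] using h1)
    rw [act_eq ht hm, ← QuotientAddGroup.mk_zsmul, QZ.mk_eq_zero_iff] at h2
    obtain ⟨k, hk⟩ := h2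
    rw [zsmul_eq_mul] at hk
    field_simp at hk
    have h3 : m = (n : ℕ) * k := by
      have : ((m : ℤ) : ℚ) = (((n : ℕ) * k : ℤ) : ℚ) := by push_cast; linear_combination -hk
      exact_mod_cast this
    apply hz
    have h4 : ((n : ℕ) : ZHat) ∣ (m : ZHat) := ⟨k, by rw [h3]; push_cast; rfl⟩
    exact (dvd_sub_left h4).1 hm
  have h := sum_divisors_add n (t := r) ht (fun s => (character z (.ofAdd s) : ℂ))
  simp only [ofAdd_add, map_mul, Circle.coe_mul, zero_add, ← Finset.mul_sum] at h
  by_contra h0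
  exact hne (mul_right_cancel₀ h0 (by rw [h, one_mul]))

/-! ### Universal C⋆-algebras -/

/-- A nonzero complex Hilbert space. -/
structure Hilb : Type 1 where
  carrier : Type
  [normedAddCommGroup : NormedAddCommGroup carrier]
  [innerProductSpace : InnerProductSpace ℂ carrier]
  [completeSpace : CompleteSpace carrier]
  [nontrivial : Nontrivial carrier]

attribute [instance] Hilb.normedAddCommGroup Hilb.innerProductSpace Hilb.completeSpace
  Hilb.nontrivial

/-- The C⋆-algebra `B(H)`. -/
abbrev Op (H : Hilb) : Type := H.carrier →L[ℂ] H.carrier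

section Product

universe u

variable {I : Type u} (H : I → Hilb)

/-- The C⋆-algebra of all bounded families `(Tᵢ)` with `Tᵢ ∈ B(Hᵢ)`. -/
def OpProd : Type u := lp (fun i => Op (H i)) ∞

/-- The C⋆-algebra structure with coordinatewise operations and the supremum norm. -/
def OpProd.cstarAlgebra : CStarAlgebra (OpProd H) where
  toNormedRing := lp.inftyNormedRing (B := fun i => Op (H i))
  toStarRing := lp.inftyStarRing (B := fun i => Op (H i))
  toCompleteSpace := inferInstanceAs (CompleteSpace (lp (fun i => Op (H i)) ∞))
  toNormedAlgebra := lp.inftyNormedAlgebra (𝕜 := ℂ) (B := fun i => Op (H i))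
  toStarModule := inferInstanceAs (StarModule ℂ (lp (fun i => Op (H i)) ∞))
  norm_mul_self_le :=
    CStarRing.norm_mul_self_le (E := (lp (fun i => Op (H i)) ∞))

instance : CStarAlgebra (OpProd H) := OpProd.cstarAlgebra H

variable {H}

/-- The coordinate homomorphism `(Tⱼ) ↦ Tᵢ`. -/
def coord (i : I) : OpProd H →⋆ₐ[ℂ] Op (H i) where
  toFun T := (show lp (fun i => Op (H i)) ∞ from T) i
  map_one' := rfl
  map_mul' _ _ := rfl
  map_zero' := rfl
  map_add' _ _ := rfl
  commutes' _ := rfl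
  map_star' _ := rfl

theorem norm_coord_le (i : I) (T : OpProd H) : ‖coord i T‖ ≤ ‖T‖ :=
  lp.norm_apply_le_norm ENNReal.top_ne_zero (show lp (fun i => Op (H i)) ∞ from T) i

theorem OpProd.norm_le {T : OpProd H} {C : ℝ} (hC : 0 ≤ C) (h : ∀ i, ‖coord i T‖ ≤ C) : ‖T‖ ≤ C :=
  lp.norm_le_of_forall_le (f := (show lp (fun i => Op (H i)) ∞ from T)) hC h

theorem OpProd.ext {S T : OpProd H} (h : ∀ i, coord i S = coord i T) : S = T :=
  lp.ext (funext h)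

/-- A family of operators with a common bound on the norms, as an element of the product. -/
def OpProd.mk (T : ∀ i, Op (H i)) (C : ℝ) (hT : ∀ i, ‖T i‖ ≤ C) : OpProd H :=
  (⟨T, memℓp_infty ⟨C, by rintro _ ⟨i, rfl⟩; exact hT i⟩⟩ : lp (fun i => Op (H i)) ∞)

theorem OpProd.coord_mk (T : ∀ i, Op (H i)) (C : ℝ) (hT : ∀ i, ‖T i‖ ≤ C) (i : I) :
    coord i (OpProd.mk T C hT) = T i := rfl

/-- The C⋆-algebra generated by a set of bounded families of operators. -/
def generatedBy (s : Set (OpProd H)) : StarSubalgebra ℂ (OpProd H) :=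
  (StarAlgebra.adjoin ℂ s).topologicalClosure

instance (s : Set (OpProd H)) : IsClosed (generatedBy s : Set (OpProd H)) :=
  StarSubalgebra.isClosed_topologicalClosure _

theorem subset_generatedBy (s : Set (OpProd H)) : s ⊆ generatedBy s :=
  (StarAlgebra.subset_adjoin ℂ s).trans (StarSubalgebra.le_topologicalClosure _)

end Product

/-! ### The group C⋆-algebra of a discrete group -/

/-- A unitary representation of the discrete group `G`. -/
structure UnitaryRep (G : Type) [Group G] : Type 1 where
  space : Hilb
  hom : G →* unitary (Op space)

section GroupAlgebra

variable {G : Type} [Group G]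

/-- The family `(U_g)_U`, indexed by the unitary representations `U` of `G`. -/
def groupGen (g : G) : OpProd (UnitaryRep.space (G := G)) :=
  OpProd.mk (fun U => (U.hom g : Op U.space)) 1
    fun U => (CStarRing.norm_of_mem_unitary (U.hom g).2).le

variable (G) in
/-- The full group C⋆-algebra `C⋆(G)`: the C⋆-algebra generated by `G` in the product of all
unitary representations of `G`. -/
def GroupCStar : StarSubalgebra ℂ (OpProd (UnitaryRep.space (G := G))) :=
  generatedBy (Set.range groupGen)

instance : IsClosed (GroupCStar G : Set (OpProd (UnitaryRep.space (G := G)))) :=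
  StarSubalgebra.isClosed_topologicalClosure _

/-- The canonical unitary `δ_g ∈ C⋆(G)`. -/
def delta (g : G) : GroupCStar G := ⟨groupGen g, subset_generatedBy _ ⟨g, rfl⟩⟩

theorem groupGen_mul (g h : G) : groupGen (g * h) = groupGen g * groupGen h := by
  refine OpProd.ext fun U => ?_
  change ((U.hom (g * h) : unitary _) : Op U.space) = U.hom g * U.hom h
  rw [map_mul]; rfl

theorem groupGen_one : groupGen (1 : G) = 1 := by
  refine OpProd.ext fun U => ?_
  change ((U.hom 1 : unitary _) : Op U.space) = 1
  rw [map_one]; rfl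

theorem star_groupGen (g : G) : star (groupGen g) = groupGen g⁻¹ := by
  refine OpProd.ext fun U => ?_
  change star ((U.hom g : unitary _) : Op U.space) = (U.hom g⁻¹ : unitary _)
  rw [map_inv]; rfl

theorem delta_mul (g h : G) : delta (g * h) = delta g * delta h := Subtype.ext (groupGen_mul g h)

theorem delta_one : delta (1 : G) = 1 := Subtype.ext groupGen_one

theorem star_delta (g : G) : star (delta g) = delta g⁻¹ := Subtype.ext (star_groupGen g)

/-- The integrated form of a unitary representation. -/
def UnitaryRep.integrated (U : UnitaryRep G) : GroupCStar G →⋆ₐ[ℂ] Op U.space :=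
  (coord U).comp (GroupCStar G).subtype

theorem UnitaryRep.integrated_delta (U : UnitaryRep G) (g : G) :
    U.integrated (delta g) = U.hom g := rfl

theorem UnitaryRep.norm_integrated_le (U : UnitaryRep G) (f : GroupCStar G) :
    ‖U.integrated f‖ ≤ ‖f‖ := norm_coord_le U _

/-- The linear span of the elements `δ_g` is dense in `C⋆(G)`. -/
theorem groupCStar_ext {E : Type*} [AddCommGroup E] [Module ℂ E] [TopologicalSpace E] [T2Space E]
    {f g : GroupCStar G →ₗ[ℂ] E} (hf : Continuous f) (hg : Continuous g)
    (h : ∀ x, f (delta x) = g (delta x)) : f = g := by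
  have h1 : Subalgebra.toSubmodule (StarAlgebra.adjoin ℂ (Set.range (groupGen (G := G)))).toSubalgebra
      ≤ (LinearMap.eqLocus f g).map (GroupCStar G).subtype.toAlgHom.toLinearMap := by
    rw [StarAlgebra.adjoin_eq_span, Submodule.span_le]
    have h2 : Submonoid.closure (Set.range (groupGen (G := G)) ∪ star (Set.range groupGen)) ≤
        ({ carrier := Set.range groupGen
           mul_mem' := by
            rintro _ _ ⟨a, rfl⟩ ⟨b, rfl⟩
            exact ⟨a * b, groupGen_mul a b⟩
           one_mem' := ⟨1, groupGen_one⟩ } : Submonoid _) := by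
      rw [Submonoid.closure_le]
      rintro x (hx | ⟨a, ha⟩)
      · exact hx
      · refine ⟨a⁻¹, ?_⟩
        rw [← star_groupGen, ha, star_star]
    intro x hx
    obtain ⟨a, rfl⟩ := h2 hx
    exact ⟨delta a, h a, rfl⟩
  have hd : Dense ((LinearMap.eqLocus f g : Submodule ℂ (GroupCStar G)) : Set (GroupCStar G)) := by
    intro x
    rw [closure_subtype]
    refine closure_mono ?_ x.2
    intro y hy
    obtain ⟨w, hw, rfl⟩ := h1 hy
    exact ⟨w, hw, rfl⟩
  have hc : IsClosed ((LinearMap.eqLocus f g : Submodule ℂ (GroupCStar G)) : Set (GroupCStar G)) :=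
    isClosed_eq hf hg
  ext x
  have : x ∈ closure ((LinearMap.eqLocus f g : Submodule ℂ (GroupCStar G)) : Set (GroupCStar G)) :=
    hd x
  rw [hc.closure_eq] at this
  exact this

end GroupAlgebra

/-! ### The action `α` of `ℕ^×` on `C⋆(ℚ/ℤ)` -/

/-- The C⋆-algebra `C⋆(ℚ/ℤ)`. -/
abbrev CStarQZ : Type 1 := GroupCStar (Multiplicative QZ)

section Average

variable {R : Type*} [Ring R] [Algebra ℂ R]

/-- `(1/n) ∑_{n s = r} U_s`. -/
def average (n : ℕ+) (U : Multiplicative QZ → R) (r : QZ) : R :=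
  ((n : ℕ) : ℂ)⁻¹ • ∑ s ∈ divisors n r, U (.ofAdd s)

theorem average_mul (n : ℕ+) {U : Multiplicative QZ → R} (hU : ∀ r s, U (r * s) = U r * U s)
    (r s : QZ) : average n U r * average n U s = average n U (r + s) := by
  have hn : ((n : ℕ) : ℂ) ≠ 0 := by exact_mod_cast n.pos.ne'
  unfold average
  rw [smul_mul_smul_comm, Finset.sum_mul]
  have : ∀ t ∈ divisors n r, U (.ofAdd t) * ∑ u ∈ divisors n s, U (.ofAdd u) =
      ∑ u ∈ divisors n (r + s), U (.ofAdd u) := by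
    intro t ht
    rw [mem_divisors] at ht
    rw [← sum_divisors_add n (t := s) ht (fun u => U (.ofAdd u)), Finset.mul_sum]
    simp only [ofAdd_add, hU]
  rw [Finset.sum_congr rfl this, Finset.sum_const, card_divisors, ← Nat.cast_smul_eq_nsmul ℂ,
    smul_smul]
  congr 1
  field_simp

variable [StarRing R]

theorem star_average [StarModule ℂ R] (n : ℕ+) {U : Multiplicative QZ → R} (hU : ∀ r, star (U r) = U r⁻¹) (r : QZ) :
    star (average n U r) = average n U (-r) := by
  unfold average
  rw [star_smul, star_sum, ← sum_divisors_neg n r (fun u => U (.ofAdd u))]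
  simp [hU]

variable (n : ℕ+) (U : Multiplicative QZ →* unitary R)

/-- `(1/n) ∑_{n s = r} U_s + (1 - (1/n) ∑_{n s = 0} U_s)`. -/
def twistFun (r : QZ) : R :=
  average n (fun r => (U r : R)) r + (1 - average n (fun r => (U r : R)) 0)

theorem twistFun_zero : twistFun n U 0 = 1 := by simp [twistFun]

theorem twistFun_mul (r s : QZ) : twistFun n U r * twistFun n U s = twistFun n U (r + s) := by
  have h : ∀ r s, average n (fun r => (U r : R)) r * average n (fun r => (U r : R)) s =
      average n (fun r => (U r : R)) (r + s) :=
    average_mul n (U := fun r => (U r : R)) fun r s => by rw [map_mul]; rfl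
  simp only [twistFun, mul_add, add_mul, mul_sub, sub_mul, h, mul_one, one_mul, add_zero, zero_add]
  abel

theorem star_twistFun [StarModule ℂ R] (r : QZ) : star (twistFun n U r) = twistFun n U (-r) := by
  have h : ∀ r, star (average n (fun r => (U r : R)) r) = average n (fun r => (U r : R)) (-r) :=
    star_average n (U := fun r => (U r : R)) fun r => by rw [map_inv]; rfl
  simp only [twistFun, star_add, star_sub, star_one, h, neg_zero]

/-- The unitary representation `r ↦ (1/n) ∑_{n s = r} U_s + (1 - (1/n) ∑_{n s = 0} U_s)`. -/
def twist [StarModule ℂ R] : Multiplicative QZ →* unitary R where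
  toFun r := ⟨twistFun n U r.toAdd, by
    rw [Unitary.mem_iff, star_twistFun, twistFun_mul, twistFun_mul]
    simp [twistFun_zero]⟩
  map_one' := Subtype.ext (twistFun_zero n U)
  map_mul' r s := Subtype.ext (twistFun_mul n U r.toAdd s.toAdd).symm

end Average

/-- The unitary representation `twist n U` on the space of `U`. -/
def UnitaryRep.twist (n : ℕ+) (U : UnitaryRep (Multiplicative QZ)) :
    UnitaryRep (Multiplicative QZ) := ⟨U.space, BostConnes.twist n U.hom⟩

/-- The endomorphism of the product of all unitary representations which replaces the coordinate
at `U` by the coordinate at `twist n U`. -/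
def shift (n : ℕ+) : OpProd (UnitaryRep.space (G := Multiplicative QZ)) →⋆ₐ[ℂ]
    OpProd (UnitaryRep.space (G := Multiplicative QZ)) where
  toFun T := OpProd.mk (H := UnitaryRep.space (G := Multiplicative QZ))
    (fun U => coord (U.twist n) T) ‖T‖ fun _ => norm_coord_le _ T
  map_one' := rfl
  map_mul' _ _ := rfl
  map_zero' := rfl
  map_add' _ _ := rfl
  commutes' _ := rfl
  map_star' _ := rfl

theorem norm_shift_le (n : ℕ+) (T : OpProd (UnitaryRep.space (G := Multiplicative QZ))) :
    ‖shift n T‖ ≤ ‖T‖ :=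
  OpProd.norm_le (norm_nonneg _) fun U => norm_coord_le (U.twist n) T

/-- `(1/n) ∑_{n s = r} δ_s`. -/
def deltaAverage (n : ℕ+) (r : QZ) : CStarQZ := average n delta r

theorem shift_delta (n : ℕ+) (r : QZ) : shift n (delta (Multiplicative.ofAdd r) : CStarQZ).1 =
    (deltaAverage n r + (1 - deltaAverage n 0) : CStarQZ).1 := by
  refine OpProd.ext fun U => ?_
  change average n (fun r => ((U.hom r : unitary (Op U.space)) : Op U.space)) r +
      (1 - average n (fun r => ((U.hom r : unitary (Op U.space)) : Op U.space)) 0) =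
    U.integrated (deltaAverage n r + (1 - deltaAverage n 0))
  simp only [map_add, map_sub, map_one, deltaAverage, average, map_smul, map_sum,
    UnitaryRep.integrated_delta]

theorem shift_mem (n : ℕ+) (f : CStarQZ) : shift n f.1 ∈ GroupCStar (Multiplicative QZ) := by
  have hc : Continuous (shift n) :=
    AddMonoidHomClass.continuous_of_bound (shift n) 1 fun T => by simpa using norm_shift_le n T
  have h : GroupCStar (Multiplicative QZ) ≤ (GroupCStar (Multiplicative QZ)).comap (shift n) := by
    refine StarSubalgebra.topologicalClosure_minimal (StarAlgebra.adjoin_le ?_) ?_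
    · rintro _ ⟨r, rfl⟩
      change shift n (delta (Multiplicative.ofAdd r.toAdd) : CStarQZ).1 ∈
        GroupCStar (Multiplicative QZ)
      rw [shift_delta]
      exact (deltaAverage n r.toAdd + (1 - deltaAverage n 0)).2
    · exact (inferInstance : IsClosed (GroupCStar (Multiplicative QZ) : Set _)).preimage hc
  exact h f.2

/-- The restriction of `shift n` to `C⋆(ℚ/ℤ)`. -/
def shiftRestrict (n : ℕ+) : CStarQZ →⋆ₐ[ℂ] CStarQZ :=
  ((shift n).comp (GroupCStar (Multiplicative QZ)).subtype).codRestrict _ (shift_mem n)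

theorem shiftRestrict_delta (n : ℕ+) (r : QZ) : shiftRestrict n (delta (.ofAdd r)) =
    deltaAverage n r + (1 - deltaAverage n 0) := Subtype.ext (shift_delta n r)

theorem norm_shiftRestrict_le (n : ℕ+) (f : CStarQZ) : ‖shiftRestrict n f‖ ≤ ‖f‖ :=
  norm_shift_le n f.1

theorem deltaAverage_mul (n : ℕ+) (r s : QZ) :
    deltaAverage n r * deltaAverage n s = deltaAverage n (r + s) :=
  average_mul n delta_mul r s

theorem star_deltaAverage (n : ℕ+) (r : QZ) : star (deltaAverage n r) = deltaAverage n (-r) :=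
  star_average n star_delta r

theorem deltaAverage_comm (n : ℕ+) (r : QZ) (f : CStarQZ) :
    deltaAverage n r * f = f * deltaAverage n r := by
  have := groupCStar_ext (f := LinearMap.mulLeft ℂ (deltaAverage n r))
    (g := LinearMap.mulRight ℂ (deltaAverage n r)) (continuous_const_mul _)
    (continuous_mul_const _) (fun x => by
      simp only [LinearMap.mulLeft_apply, LinearMap.mulRight_apply, deltaAverage, average,
        smul_mul_assoc, mul_smul_comm, Finset.sum_mul, Finset.mul_sum, ← delta_mul, mul_comm])
  exact LinearMap.congr_fun this f

/-- The endomorphism `αₙ` of `C⋆(ℚ/ℤ)`. It is determined by `αₙ(δ_r) = (1/n) ∑_{n s = r} δ_s`, see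
`alphaEnd_delta`. -/
def alphaEnd (n : ℕ+) : CStarQZ →⋆ₙₐ[ℂ] CStarQZ where
  toFun f := deltaAverage n 0 * shiftRestrict n f
  map_smul' c f := by simp
  map_zero' := by simp
  map_add' f g := by simp [mul_add]
  map_mul' f g := by
    rw [map_mul, mul_assoc, ← mul_assoc _ (deltaAverage n 0), ← deltaAverage_comm n 0,
      ← mul_assoc, ← mul_assoc, ← mul_assoc, deltaAverage_mul, add_zero]
  map_star' f := by
    rw [map_star, star_mul, star_deltaAverage, neg_zero, deltaAverage_comm]

theorem alphaEnd_delta (n : ℕ+) (r : QZ) : alphaEnd n (delta (.ofAdd r)) =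
    ((n : ℕ) : ℂ)⁻¹ • ∑ s ∈ divisors n r, delta (.ofAdd s) := by
  change deltaAverage n 0 * shiftRestrict n (delta (.ofAdd r)) = deltaAverage n r
  rw [shiftRestrict_delta, mul_add, mul_sub, deltaAverage_mul, deltaAverage_mul, mul_one]
  simp

theorem continuous_alphaEnd (n : ℕ+) : Continuous (alphaEnd n) := by
  have hc : Continuous (shiftRestrict n) :=
    AddMonoidHomClass.continuous_of_bound (shiftRestrict n) 1 fun T => by
      simpa using norm_shiftRestrict_le n T
  exact continuous_const.mul hc

/-- The action `α` of the multiplicative semigroup `ℕ^×` of positive integers by endomorphisms of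
`C⋆(ℚ/ℤ)`, where `αₙ(δ_r) = (1/n) ∑_{n s = r} δ_s`. -/
def alpha : ℕ+ →* (CStarQZ →⋆ₙₐ[ℂ] CStarQZ) where
  toFun := alphaEnd
  map_one' := by
    have := groupCStar_ext (f := (alphaEnd 1 : CStarQZ →ₗ[ℂ] CStarQZ)) (g := LinearMap.id)
      (continuous_alphaEnd 1) continuous_id (fun r => by
        change alphaEnd 1 (delta (.ofAdd r.toAdd)) = delta (.ofAdd r.toAdd)
        rw [alphaEnd_delta]
        have : divisors 1 r.toAdd = {r.toAdd} := by ext s; simp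
        simp [this])
    exact NonUnitalStarAlgHom.ext fun f => LinearMap.congr_fun this f
  map_mul' m n := by
    have := groupCStar_ext (f := (alphaEnd (m * n) : CStarQZ →ₗ[ℂ] CStarQZ))
      (g := (alphaEnd m : CStarQZ →ₗ[ℂ] CStarQZ) ∘ₗ (alphaEnd n : CStarQZ →ₗ[ℂ] CStarQZ))
      (continuous_alphaEnd _) ((continuous_alphaEnd m).comp (continuous_alphaEnd n)) (fun r => by
        change alphaEnd (m * n) (delta (.ofAdd r.toAdd)) =
          alphaEnd m (alphaEnd n (delta (.ofAdd r.toAdd)))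
        simp only [alphaEnd_delta, map_smul, map_sum]
        rw [← Finset.smul_sum, smul_smul, mul_comm m n, sum_divisors_mul]
        congr 1
        rw [PNat.mul_coe, Nat.cast_mul, mul_inv])
    exact NonUnitalStarAlgHom.ext fun f => LinearMap.congr_fun this f

/-! ### Crossed products by semigroups of endomorphisms -/

section CrossedProduct

universe u

variable {A : Type u} [CStarAlgebra A] {S : Type} [Monoid S]

/-- A covariant representation `(π, V)` of the system `(A, S, α)`: a unital representation `π` of
`A` and a representation `V` of `S` by isometries such that `π(α_s(a)) = V_s π(a) V_s⋆`. -/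
structure CovariantRep (α : S →* (A →⋆ₙₐ[ℂ] A)) : Type (max u 1) where
  space : Hilb
  rep : A →⋆ₐ[ℂ] Op space
  isom : S →* Op space
  star_isom_mul_isom : ∀ s, star (isom s) * isom s = 1
  covariant : ∀ s a, rep (α s a) = isom s * rep a * star (isom s)

variable (α : S →* (A →⋆ₙₐ[ℂ] A))

/-- The family `(π(a))`, indexed by the covariant representations `(π, V)`. -/
def crossedGenAlg (a : A) : OpProd (CovariantRep.space (α := α)) :=
  OpProd.mk (fun ρ => ρ.rep a) ‖a‖ fun ρ => NonUnitalStarAlgHom.norm_apply_le ρ.rep a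

/-- The family `(V_s)`, indexed by the covariant representations `(π, V)`. -/
def crossedGenIsom (s : S) : OpProd (CovariantRep.space (α := α)) :=
  OpProd.mk (fun ρ => ρ.isom s) 1 fun ρ => by
    have h := CStarRing.norm_star_mul_self (x := ρ.isom s)
    rw [ρ.star_isom_mul_isom, norm_one] at h
    nlinarith [norm_nonneg (ρ.isom s)]

/-- The semigroup crossed product `A ⋊_α S`: the C⋆-algebra generated by the images of `A` and `S`
in the product of all covariant representations. -/
def CrossedProduct : StarSubalgebra ℂ (OpProd (CovariantRep.space (α := α))) :=
  generatedBy (Set.range (crossedGenAlg α) ∪ Set.range (crossedGenIsom α))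

instance : IsClosed (CrossedProduct α : Set (OpProd (CovariantRep.space (α := α)))) :=
  StarSubalgebra.isClosed_topologicalClosure _

/-- The canonical map `A → A ⋊_α S`. -/
def crossedAlg (a : A) : CrossedProduct α :=
  ⟨crossedGenAlg α a, subset_generatedBy _ (Or.inl ⟨a, rfl⟩)⟩

/-- The canonical map `S → A ⋊_α S`. -/
def crossedIsom (s : S) : CrossedProduct α :=
  ⟨crossedGenIsom α s, subset_generatedBy _ (Or.inr ⟨s, rfl⟩)⟩

variable {α}

/-- The representation `π × V` of `A ⋊_α S` given by a covariant representation `(π, V)`. It is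
determined by `(π × V)(a) = π(a)` for `a ∈ A` and `(π × V)(s) = V_s` for `s ∈ S`. -/
def CovariantRep.integrated (ρ : CovariantRep α) : CrossedProduct α →⋆ₐ[ℂ] Op ρ.space :=
  (coord ρ).comp (CrossedProduct α).subtype

theorem CovariantRep.integrated_crossedAlg (ρ : CovariantRep α) (a : A) :
    ρ.integrated (crossedAlg α a) = ρ.rep a := rfl

theorem CovariantRep.integrated_crossedIsom (ρ : CovariantRep α) (s : S) :
    ρ.integrated (crossedIsom α s) = ρ.isom s := rfl

end CrossedProduct

/-- The Bost-Connes algebra `C⋆(ℚ/ℤ) ⋊_α ℕ^×`. -/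
abbrev CQ : Type 1 := CrossedProduct alpha

/-! ### The representations `π_a × V` -/

/-- The character `z` of `ℚ/ℤ` as a unitary representation on `ℂ`. -/
def characterRep (z : ZHat) : UnitaryRep (Multiplicative QZ) where
  space := ⟨ℂ⟩
  hom :=
    { toFun := fun r => ⟨(character z r : ℂ) • (1 : ℂ →L[ℂ] ℂ), by
        have h : star ((character z r : Circle) : ℂ) * (character z r : Circle) = 1 := by
          rw [mul_comm, Complex.star_def, Complex.mul_conj, Circle.normSq_coe, Complex.ofReal_one]
        rw [Unitary.mem_iff, star_smul, star_one, smul_mul_smul_comm, smul_mul_smul_comm, h,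
          mul_comm, h]
        simp⟩
      map_one' := Subtype.ext (by simp)
      map_mul' := fun r s => Subtype.ext (by simp [smul_smul, mul_comm]) }

/-- The Fourier transform `f̂(z)` of `f ∈ C⋆(ℚ/ℤ)` at `z ∈ 𝒵`: the value at `f` of the
homomorphism `C⋆(ℚ/ℤ) → ℂ` given by the character `z`. -/
def fourier (f : CStarQZ) (z : ZHat) : ℂ :=
  (show ℂ →L[ℂ] ℂ from (characterRep z).integrated f) 1

theorem fourier_eq (f : CStarQZ) (z : ZHat) :
    (show ℂ →L[ℂ] ℂ from (characterRep z).integrated f) = fourier f z • (1 : ℂ →L[ℂ] ℂ) := by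
  ext
  simp [fourier]

theorem fourier_delta (r : QZ) (z : ZHat) :
    fourier (delta (.ofAdd r)) z = character z (.ofAdd r) := by
  change ((character z (.ofAdd r) : ℂ) • (1 : ℂ →L[ℂ] ℂ)) 1 = _
  simp

theorem fourier_mul (f g : CStarQZ) (z : ZHat) :
    fourier (f * g) z = fourier f z * fourier g z := by
  have h : (show ℂ →L[ℂ] ℂ from (characterRep z).integrated (f * g)) =
    (show ℂ →L[ℂ] ℂ from (characterRep z).integrated f) *
      (show ℂ →L[ℂ] ℂ from (characterRep z).integrated g) := map_mul (characterRep z).integrated f g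
  rw [fourier_eq, fourier_eq, fourier_eq] at h
  simpa [mul_comm] using congrArg (fun T : ℂ →L[ℂ] ℂ => T 1) h

theorem fourier_star (f : CStarQZ) (z : ZHat) : fourier (star f) z = star (fourier f z) := by
  have h : (show ℂ →L[ℂ] ℂ from (characterRep z).integrated (star f)) =
    star (show ℂ →L[ℂ] ℂ from (characterRep z).integrated f) :=
      map_star (characterRep z).integrated f
  rw [fourier_eq, fourier_eq, star_smul, star_one] at h
  simpa using congrArg (fun T : ℂ →L[ℂ] ℂ => T 1) h

/-- `f ↦ f̂(z)` as a linear map. -/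
def fourierLinear (z : ZHat) : CStarQZ →ₗ[ℂ] ℂ where
  toFun f := fourier f z
  map_add' f g := by
    change (show ℂ →L[ℂ] ℂ from (characterRep z).integrated (f + g)) 1 = _
    rw [map_add]; rfl
  map_smul' c f := by
    change (show ℂ →L[ℂ] ℂ from (characterRep z).integrated (c • f)) 1 = _
    rw [map_smul]; rfl

theorem fourier_one (z : ZHat) : fourier 1 z = 1 := by
  have h : (characterRep z).integrated 1 = 1 := map_one _
  change (show ℂ →L[ℂ] ℂ from (characterRep z).integrated 1) 1 = _
  rw [h]; rfl

theorem norm_fourier_le (f : CStarQZ) (z : ZHat) : ‖fourier f z‖ ≤ ‖f‖ := by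
  have h := (characterRep z).norm_integrated_le f
  have h2 := ContinuousLinearMap.le_opNorm
    (show ℂ →L[ℂ] ℂ from (characterRep z).integrated f) 1
  rw [norm_one, mul_one] at h2
  exact h2.trans h

theorem continuous_fourier (z : ZHat) : Continuous (fourierLinear z) :=
  AddMonoidHomClass.continuous_of_bound (fourierLinear z) 1 fun f =>
    (norm_fourier_le f z).trans_eq (one_mul _).symm

theorem fourier_alpha_delta (n : ℕ+) (r : QZ) (z : ZHat) :
    fourier (alpha n (delta (.ofAdd r))) z =
      ((n : ℕ) : ℂ)⁻¹ * ∑ s ∈ divisors n r, (character z (.ofAdd s) : ℂ) := by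
  change fourierLinear z (alphaEnd n (delta (.ofAdd r))) = _
  rw [alphaEnd_delta, map_smul, map_sum, smul_eq_mul]
  exact congrArg _ (Finset.sum_congr rfl fun s _ => fourier_delta s z)

theorem fourier_alpha (n : ℕ+) (f : CStarQZ) (w : ZHat) :
    fourier (alpha n f) ((n : ℕ) * w) = fourier f w := by
  have := groupCStar_ext
    (f := fourierLinear ((n : ℕ) * w) ∘ₗ (alphaEnd n : CStarQZ →ₗ[ℂ] CStarQZ))
    (g := fourierLinear w) ((continuous_fourier _).comp (continuous_alphaEnd n))
    (continuous_fourier w) (fun r => by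
      change fourier (alpha n (delta (.ofAdd r.toAdd))) _ = fourier (delta (.ofAdd r.toAdd)) w
      have hn : ((n : ℕ) : ℂ) ≠ 0 := by exact_mod_cast n.pos.ne'
      rw [fourier_alpha_delta, sum_character_mul, fourier_delta, inv_mul_cancel_left₀ hn])
  exact LinearMap.congr_fun this f

theorem fourier_alpha_of_not_dvd (n : ℕ+) (f : CStarQZ) {z : ZHat} (hz : ¬ ((n : ℕ) : ZHat) ∣ z) :
    fourier (alpha n f) z = 0 := by
  have := groupCStar_ext
    (f := fourierLinear z ∘ₗ (alphaEnd n : CStarQZ →ₗ[ℂ] CStarQZ))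
    (g := 0) ((continuous_fourier _).comp (continuous_alphaEnd n))
    continuous_zero (fun r => by
      change fourier (alpha n (delta (.ofAdd r.toAdd))) _ = 0
      rw [fourier_alpha_delta, sum_character_of_not_dvd n hz, mul_zero])
  exact LinearMap.congr_fun this f

/-- The index set `{r ∈ ℚ⋆₊ : r a ∈ 𝒵}`. -/
def Index (a : ZHat) : Type :=
  {r : ℚ // 0 < r ∧ ∀ p : Nat.Primes, ‖(r : ℚ_[(p : ℕ)]) * (a p : ℚ_[(p : ℕ)])‖ ≤ 1}

namespace Index

variable {a : ZHat}

instance : DecidableEq (Index a) := Classical.decEq _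

/-- The element `r a` of `𝒵`. -/
def point (r : Index a) : ZHat := fun p => ⟨(r.1 : ℚ_[(p : ℕ)]) * (a p : ℚ_[(p : ℕ)]), r.2.2 p⟩

/-- The element `1` of the index set. -/
def one (a : ZHat) : Index a := ⟨1, one_pos, fun p => by simpa using (a p).2⟩

theorem coe_natCast_mul_point (n : ℕ+) (r : Index a) (p : Nat.Primes) :
    (((n : ℕ) * r.1 : ℚ) : ℚ_[(p : ℕ)]) * (a p : ℚ_[(p : ℕ)]) =
      ((((n : ℕ) : ℤ_[(p : ℕ)]) * r.point p : ℤ_[(p : ℕ)]) : ℚ_[(p : ℕ)]) := by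
  rw [PadicInt.coe_mul, PadicInt.coe_natCast, Rat.cast_mul, Rat.cast_natCast, mul_assoc]
  rfl

/-- Multiplication by a positive integer. -/
def mul (n : ℕ+) (r : Index a) : Index a :=
  ⟨(n : ℕ) * r.1, mul_pos (by exact_mod_cast n.pos) r.2.1, fun p => by
    rw [coe_natCast_mul_point]
    exact PadicInt.norm_le_one _⟩

theorem point_mul (n : ℕ+) (r : Index a) : (mul n r).point = (n : ℕ) * r.point :=
  funext fun p => Subtype.ext (coe_natCast_mul_point n r p)

theorem mul_injective (n : ℕ+) : Function.Injective (mul n : Index a → Index a) := by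
  intro r s h
  have hn : ((n : ℕ) : ℚ) ≠ 0 := by exact_mod_cast n.pos.ne'
  exact Subtype.ext (mul_left_cancel₀ hn (congrArg Subtype.val h))

theorem mul_mul (m n : ℕ+) (r : Index a) : mul (m * n) r = mul m (mul n r) :=
  Subtype.ext (by simp [mul, mul_assoc])

theorem one_mul (r : Index a) : mul 1 r = r := Subtype.ext (by simp [mul])

theorem exists_of_dvd (n : ℕ+) (s : Index a) (h : ((n : ℕ) : ZHat) ∣ s.point) :
    ∃ r, mul n r = s := by
  obtain ⟨w, hw⟩ := h
  have hn : ((n : ℕ) : ℚ) ≠ 0 := by exact_mod_cast n.pos.ne'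
  refine ⟨⟨s.1 / (n : ℕ), div_pos s.2.1 (by exact_mod_cast n.pos), fun p => ?_⟩,
    Subtype.ext (mul_div_cancel₀ s.1 hn)⟩
  have h1 : (s.1 : ℚ_[(p : ℕ)]) * (a p : ℚ_[(p : ℕ)]) = ((n : ℕ) : ℚ_[(p : ℕ)]) * (w p) := by
    have := congrArg Subtype.val (congrFun hw p)
    simpa [point] using this
  have hn' : ((n : ℕ) : ℚ_[(p : ℕ)]) ≠ 0 := by exact_mod_cast n.pos.ne'
  have h2 : ((s.1 / (n : ℕ) : ℚ) : ℚ_[(p : ℕ)]) * (a p : ℚ_[(p : ℕ)]) = w p := by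
    push_cast
    field_simp
    rw [h1]
  rw [h2]
  exact (w p).2

end Index

section RepA

variable (a : ZHat)

/-- The Hilbert space `ℓ²({r ∈ ℚ⋆₊ : r a ∈ 𝒵})`. -/
abbrev EllTwo : Type := lp (fun _ : Index a => ℂ) 2

variable {a} in
/-- The canonical orthonormal basis `(e_r)`. -/
def basisVec (r : Index a) : EllTwo a := lp.single 2 r (1 : ℂ)

instance : Nontrivial (EllTwo a) := by
  refine ⟨basisVec (Index.one a), 0, fun h => ?_⟩
  have := congrArg (fun ξ : EllTwo a => ξ (Index.one a)) h
  simp [basisVec] at this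

theorem orthonormal_basisVec : Orthonormal ℂ (basisVec : Index a → EllTwo a) := by
  rw [orthonormal_iff_ite]
  intro r s
  rw [basisVec, basisVec, lp.inner_single_left]
  by_cases h : r = s
  · subst h; simp
  · simp [h]

variable {a} in
theorem ellTwo_ext {T S : EllTwo a →L[ℂ] EllTwo a} (h : ∀ r, T (basisVec r) = S (basisVec r)) :
    T = S := by
  refine lp.ext_continuousLinearMap (by simp) fun r => ?_
  ext1
  exact h r

/-- The operator `V_n` with `V_n e_r = e_{n r}`. -/
def isomOp (n : ℕ+) : EllTwo a →L[ℂ] EllTwo a :=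
  ((orthonormal_basisVec a).comp _ (Index.mul_injective n)).orthogonalFamily.linearIsometry
    |>.toContinuousLinearMap

variable {a}

theorem isomOp_basisVec (n : ℕ+) (r : Index a) : isomOp a n (basisVec r) = basisVec (r.mul n) := by
  refine ((((orthonormal_basisVec a).comp _ (Index.mul_injective n)).orthogonalFamily).linearIsometry_apply_single
    (i := r) (1 : ℂ)).trans ?_
  simp

theorem star_isomOp_mul_isomOp (n : ℕ+) : star (isomOp a n) * isomOp a n = 1 := by
  ext1 ξ
  refine ext_inner_right ℂ fun η => ?_
  change inner ℂ ((isomOp a n).adjoint (isomOp a n ξ)) η = inner ℂ ξ η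
  rw [ContinuousLinearMap.adjoint_inner_left]
  exact LinearIsometry.inner_map_map _ ξ η

theorem star_isomOp_basisVec (n : ℕ+) (r : Index a) :
    star (isomOp a n) (basisVec (r.mul n)) = basisVec r := by
  rw [← isomOp_basisVec]
  exact congrArg (fun T : EllTwo a →L[ℂ] EllTwo a => T (basisVec r)) (star_isomOp_mul_isomOp n)

theorem star_isomOp_basisVec_of_ne (n : ℕ+) {s : Index a} (hs : ∀ r : Index a, r.mul n ≠ s) :
    star (isomOp a n) (basisVec s) = 0 := by
  ext r
  have h1 : inner ℂ (basisVec r) (star (isomOp a n) (basisVec s)) = (0 : ℂ) := by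
    change inner ℂ (basisVec r) ((isomOp a n).adjoint (basisVec s)) = (0 : ℂ)
    rw [ContinuousLinearMap.adjoint_inner_right, isomOp_basisVec,
      orthonormal_iff_ite.1 (orthonormal_basisVec a), if_neg (hs r)]
  rw [basisVec, lp.inner_single_left] at h1
  simpa using h1

/-- The diagonal operator `π_a(f)`, with `π_a(f) e_r = f̂(r a) e_r`. -/
def diagOp (a : ZHat) (f : CStarQZ) : EllTwo a →L[ℂ] EllTwo a :=
  LinearMap.mkContinuous
    { toFun := fun ξ => ⟨fun r => fourier f r.point * ξ r,
        ((lp.memℓp ξ).const_smul (‖f‖ : ℂ)).mono' fun r => by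
          rw [norm_mul, Pi.smul_apply, norm_smul, Complex.norm_real, norm_norm]
          exact mul_le_mul_of_nonneg_right (norm_fourier_le f _) (norm_nonneg _)⟩
      map_add' := fun ξ η => by
        ext r
        exact mul_add _ _ _
      map_smul' := fun c ξ => by
        ext r
        exact mul_left_comm _ _ _ } ‖f‖ fun ξ => by
    refine (lp.norm_mono (y := (‖f‖ : ℂ) • ξ) two_ne_zero fun r => ?_).trans ?_
    · change ‖fourier f r.point * ξ r‖ ≤ ‖(‖f‖ : ℂ) * ξ r‖
      rw [norm_mul, norm_mul, Complex.norm_real, norm_norm]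
      exact mul_le_mul_of_nonneg_right (norm_fourier_le f _) (norm_nonneg _)
    · rw [norm_smul, Complex.norm_real, norm_norm]

theorem diagOp_apply (f : CStarQZ) (ξ : EllTwo a) (r : Index a) :
    diagOp a f ξ r = fourier f r.point * ξ r := rfl

theorem diagOp_basisVec (f : CStarQZ) (r : Index a) :
    diagOp a f (basisVec r) = fourier f r.point • basisVec r := by
  ext s
  rw [diagOp_apply, lp.coeFn_smul, Pi.smul_apply, smul_eq_mul]
  by_cases h : s = r
  · rw [h]
  · simp [basisVec, h]

/-- The representation `π_a` of `C⋆(ℚ/ℤ)`. -/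
def diagRep (a : ZHat) : CStarQZ →⋆ₐ[ℂ] (EllTwo a →L[ℂ] EllTwo a) where
  toFun := diagOp a
  map_one' := ellTwo_ext fun r => by
    rw [diagOp_basisVec, fourier_one, one_smul]; rfl
  map_mul' f g := ellTwo_ext fun r => by
    rw [mul_apply_eq_comp, diagOp_basisVec, diagOp_basisVec, map_smul, diagOp_basisVec,
      smul_smul, fourier_mul, mul_comm]
  map_zero' := ellTwo_ext fun r => by
    have : fourier 0 r.point = 0 := (fourierLinear r.point).map_zero
    rw [diagOp_basisVec, this, zero_smul]; rfl
  map_add' f g := ellTwo_ext fun r => by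
    have : fourier (f + g) r.point = fourier f r.point + fourier g r.point :=
      (fourierLinear r.point).map_add f g
    rw [diagOp_basisVec, this, add_smul, add_apply, diagOp_basisVec,
      diagOp_basisVec]
  commutes' c := ellTwo_ext fun r => by
    have : fourier (algebraMap ℂ CStarQZ c) r.point = c := by
      rw [Algebra.algebraMap_eq_smul_one]
      have h := (fourierLinear r.point).map_smul c 1
      change fourier (c • 1) r.point = c * fourier 1 r.point at h
      rw [h, fourier_one, mul_one]
    rw [diagOp_basisVec, this, Algebra.algebraMap_eq_smul_one]
    rfl
  map_star' f := by
    refine (ContinuousLinearMap.eq_adjoint_iff _ _).2 fun ξ η => ?_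
    rw [lp.inner_eq_tsum, lp.inner_eq_tsum]
    refine tsum_congr fun r => ?_
    simp only [diagOp_apply, fourier_star, RCLike.inner_apply, map_mul]
    simp
    ring

/-- The covariant representation `(π_a, V)` of `(C⋆(ℚ/ℤ), ℕ^×, α)` on
`ℓ²({r ∈ ℚ⋆₊ : r a ∈ 𝒵})`. -/
def covariantRep (a : ZHat) : CovariantRep alpha where
  space := ⟨EllTwo a⟩
  rep := diagRep a
  isom :=
    { toFun := isomOp a
      map_one' := ellTwo_ext fun r => by rw [isomOp_basisVec, Index.one_mul]; rfl
      map_mul' := fun m n => ellTwo_ext fun r => by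
        rw [mul_apply_eq_comp, isomOp_basisVec, isomOp_basisVec, isomOp_basisVec,
          Index.mul_mul] }
  star_isom_mul_isom := star_isomOp_mul_isomOp
  covariant n f := ellTwo_ext fun s => by
    change diagOp a (alpha n f) (basisVec s) =
      isomOp a n (diagOp a f (star (isomOp a n) (basisVec s)))
    rw [diagOp_basisVec]
    by_cases hs : ∃ r, Index.mul n r = s
    · obtain ⟨r, rfl⟩ := hs
      rw [star_isomOp_basisVec, diagOp_basisVec, map_smul, isomOp_basisVec, Index.point_mul,
        fourier_alpha]
    · rw [star_isomOp_basisVec_of_ne n (not_exists.1 hs), map_zero, map_zero,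
        fourier_alpha_of_not_dvd n f fun h => hs (Index.exists_of_dvd n s h), zero_smul]

/-- The representation `π_a × V` of the Bost-Connes algebra. -/
def piV (a : ZHat) : CQ →⋆ₐ[ℂ] (EllTwo a →L[ℂ] EllTwo a) := (covariantRep a).integrated

end RepA

/-- Unitary equivalence of representations on Hilbert spaces. -/
def UnitarilyEquivalent {B H K : Type*} [Semiring B] [Algebra ℂ B] [Star B]
    [NormedAddCommGroup H] [InnerProductSpace ℂ H] [CompleteSpace H]
    [NormedAddCommGroup K] [InnerProductSpace ℂ K] [CompleteSpace K]
    (ρ : B →⋆ₐ[ℂ] (H →L[ℂ] H)) (σ : B →⋆ₐ[ℂ] (K →L[ℂ] K)) : Prop :=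
  ∃ W : H ≃ₗᵢ[ℂ] K, ∀ (T : B) (ξ : H), W (ρ T ξ) = σ T (W ξ)

/-- `a` and `b` lie in the same orbit of the action of `ℚ⋆₊` by multiplication on the finite adeles:
`b_p = r a_p` in `ℚ_p` for all primes `p`, for some positive rational number `r`. -/
def SameOrbit (a b : ZHat) : Prop :=
  ∃ r : ℚ, 0 < r ∧ ∀ p : Nat.Primes,
    (b p : ℚ_[(p : ℕ)]) = (r : ℚ_[(p : ℕ)]) * (a p : ℚ_[(p : ℕ)])

end

end BostConnes

/-!
Faithfulness of `π_a × V` when no coordinate of `a` vanishes rests on the gauge action. The compact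
group of multiplicative functions `χ : ℕ^× → 𝕋` acts on the Bost-Connes algebra by replacing each
covariant pair `(π, V)` by `(π, χ V)`. Averaging a vector functional of a representation over this
group annihilates the off-diagonal monomials `V_m⋆ δ_r V_n`, `m ≠ n`, since the functions `n ^ (it)`
separate the positive integers (`integral_gauge_of_ne`). The diagonal ones are
`V_n⋆ δ_r V_n = δ_{nr}`, so on the dense span of the monomials the average is given by an element `f`
of the group algebra of some `n⁻¹ℤ/ℤ`, whose Fourier transform at `r a` is also the diagonal
coefficient at `e_r` in the representation `π_a × V` (`exists_expectation`).

By Gelfand duality `‖f‖` is the supremum of `|f̂|` over `ℤ ⊆ 𝒵` (`norm_le_of_fourier_le`). The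
multiples `r a` in `𝒵` are dense when all `a_p ≠ 0` (`exists_index_point_dvd_sub`), so `‖f‖` is at
most the norm in `π_a × V`. Hence the average of every vector functional of every covariant
representation is dominated by the norm of `π_a × V` (`norm_averageLinear_le`). If
`(π_a × V)(x) = 0`, then the averages of `x⋆ x` vanish. Their integrands are continuous and
nonnegative on the group, so they vanish at the identity, and `x = 0`. Conversely, if `a_p = 0` then
`δ_{1/p} - 1` is a nonzero element of the kernel.

For unitary equivalence: `e_1` is a joint eigenvector of `π_a` with character `a`, and the characters
occurring in `π_b` are the points `s b`, which gives `a = s b`. If `b = t a`, then `e_r ↦ e_{r/t}` is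
an intertwining unitary.
-/

namespace BostConnes

noncomputable section

/-! ### Monomials in a semigroup crossed product -/

section Monomials

universe u

variable {A : Type u} [CStarAlgebra A] {S : Type} [CommMonoid S] {α : S →* (A →⋆ₙₐ[ℂ] A)}

theorem CovariantRep.isom_mul_rep (ρ : CovariantRep α) (s : S) (f : A) :
    ρ.isom s * ρ.rep f = ρ.rep (α s f) * ρ.isom s := by
  rw [ρ.covariant, mul_assoc, ρ.star_isom_mul_isom, mul_one]

theorem CovariantRep.rep_mul_star_isom (ρ : CovariantRep α) (s : S) (f : A) :
    ρ.rep f * star (ρ.isom s) = star (ρ.isom s) * ρ.rep (α s f) := by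
  rw [ρ.covariant, mul_assoc, ← mul_assoc (star (ρ.isom s)), ρ.star_isom_mul_isom, one_mul]

/-- The Ore-type relation which moves adjoints of isometries to the left. It rests on the
commutativity of `S`. -/
theorem CovariantRep.isom_mul_star_isom (ρ : CovariantRep α) (s t : S) :
    ρ.isom s * star (ρ.isom t) =
      star (ρ.isom t) * ρ.rep (α s (α t 1)) * ρ.isom s := by
  have h1 : ρ.rep (α t 1) = ρ.isom t * star (ρ.isom t) := by
    rw [ρ.covariant, map_one, mul_one]
  calc ρ.isom s * star (ρ.isom t)
      = star (ρ.isom t) * (ρ.isom t * ρ.isom s) * star (ρ.isom t) := by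
        rw [← mul_assoc, ρ.star_isom_mul_isom, one_mul]
    _ = star (ρ.isom t) * (ρ.isom s * ρ.isom t) * star (ρ.isom t) := by
        rw [← map_mul, mul_comm t s, map_mul]
    _ = star (ρ.isom t) * (ρ.isom s * ρ.rep (α t 1)) := by
        rw [h1]; simp only [mul_assoc]
    _ = _ := by rw [ρ.isom_mul_rep, mul_assoc]

variable (α) in
/-- The element `V_s⋆ f V_t` of the crossed product. -/
def monomial (s : S) (f : A) (t : S) : CrossedProduct α :=
  star (crossedIsom α s) * crossedAlg α f * crossedIsom α t

theorem CovariantRep.integrated_monomial (ρ : CovariantRep α) (s t : S) (f : A) :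
    ρ.integrated (monomial α s f t) = star (ρ.isom s) * ρ.rep f * ρ.isom t := by
  rw [monomial, map_mul, map_mul, map_star]
  rfl

theorem crossedProduct_ext {x y : CrossedProduct α}
    (h : ∀ ρ : CovariantRep α, ρ.integrated x = ρ.integrated y) : x = y :=
  Subtype.ext (OpProd.ext h)

theorem norm_integrated_le (ρ : CovariantRep α) (x : CrossedProduct α) :
    ‖ρ.integrated x‖ ≤ ‖x‖ := norm_coord_le ρ _

theorem CovariantRep.continuous_integrated (ρ : CovariantRep α) : Continuous ρ.integrated :=
  AddMonoidHomClass.continuous_of_bound ρ.integrated 1 fun x =>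
    (norm_integrated_le ρ x).trans_eq (one_mul _).symm

theorem monomial_mul (m n k l : S) (f g : A) :
    monomial α m f n * monomial α k g l =
      monomial α (k * m) (α k f * α n (α k 1) * α n g) (n * l) := by
  refine crossedProduct_ext fun ρ => ?_
  simp only [map_mul, ρ.integrated_monomial, star_mul]
  calc star (ρ.isom m) * ρ.rep f * ρ.isom n * (star (ρ.isom k) * ρ.rep g * ρ.isom l)
      = star (ρ.isom m) * ρ.rep f * (ρ.isom n * star (ρ.isom k)) * ρ.rep g * ρ.isom l := by
        simp only [mul_assoc]
    _ = star (ρ.isom m) * (ρ.rep f * star (ρ.isom k)) * ρ.rep (α n (α k 1)) *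
          (ρ.isom n * ρ.rep g) * ρ.isom l := by
        rw [ρ.isom_mul_star_isom]; simp only [mul_assoc]
    _ = _ := by
        rw [ρ.isom_mul_rep, ρ.rep_mul_star_isom]; simp only [mul_assoc]

theorem star_monomial (m n : S) (f : A) :
    star (monomial α m f n) = monomial α n (star f) m := by
  refine crossedProduct_ext fun ρ => ?_
  simp only [map_star, ρ.integrated_monomial, star_mul, star_star, mul_assoc]

variable (α) in
/-- The monomial `V_s⋆ f V_t` as a linear function of `f`. -/
def monomialLinear (s t : S) : A →ₗ[ℂ] CrossedProduct α where
  toFun f := monomial α s f t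
  map_add' f g := crossedProduct_ext fun ρ => by
    simp only [map_add, ρ.integrated_monomial, mul_add, add_mul]
  map_smul' c f := crossedProduct_ext fun ρ => by
    simp only [map_smul, ρ.integrated_monomial, mul_smul_comm, smul_mul_assoc, RingHom.id_apply]

theorem continuous_monomial (s t : S) : Continuous (monomialLinear α s t) := by
  have h : ∀ f, ‖crossedAlg α f‖ ≤ ‖f‖ := fun f =>
    OpProd.norm_le (norm_nonneg f) fun ρ => NonUnitalStarAlgHom.norm_apply_le ρ.rep f
  refine AddMonoidHomClass.continuous_of_bound (monomialLinear α s t)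
    (‖star (crossedIsom α s)‖ * ‖crossedIsom α t‖) fun f => ?_
  calc ‖star (crossedIsom α s) * crossedAlg α f * crossedIsom α t‖
      ≤ ‖star (crossedIsom α s)‖ * ‖crossedAlg α f‖ * ‖crossedIsom α t‖ :=
        (norm_mul_le _ _).trans (by gcongr; exact norm_mul_le _ _)
    _ ≤ ‖star (crossedIsom α s)‖ * ‖f‖ * ‖crossedIsom α t‖ := by gcongr; exact h f
    _ = _ := by ring

/-- The monomials span a dense subspace of the crossed product. -/
theorem eq_top_of_monomial_mem (P : Submodule ℂ (CrossedProduct α))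
    (hP : IsClosed (P : Set (CrossedProduct α))) (h : ∀ s f t, monomial α s f t ∈ P) : P = ⊤ := by
  set gen := Set.range (crossedGenAlg α) ∪ Set.range (crossedGenIsom α)
  have halg : ∀ f, (monomial α 1 f 1).1 = crossedGenAlg α f := fun f => OpProd.ext fun ρ => by
    refine (ρ.integrated_monomial 1 1 f).trans ?_
    rw [map_one, star_one, one_mul, mul_one]; rfl
  have hisom : ∀ s, (monomial α 1 1 s).1 = crossedGenIsom α s := fun s => OpProd.ext fun ρ => by
    refine (ρ.integrated_monomial 1 s 1).trans ?_
    rw [map_one, map_one, star_one, one_mul, one_mul]; rfl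
  have h2 : Submonoid.closure (gen ∪ star gen) ≤
      ({ carrier := {x | ∃ s f t, (monomial α s f t).1 = x}
         mul_mem' := by
          rintro _ _ ⟨s, f, t, rfl⟩ ⟨s', f', t', rfl⟩
          exact ⟨_, _, _, congrArg Subtype.val (monomial_mul s t s' t' f f').symm⟩
         one_mem' := ⟨1, 1, 1, by rw [hisom]; exact OpProd.ext fun ρ => map_one ρ.isom⟩ } :
        Submonoid _) := by
    have hgen : ∀ x ∈ gen, ∃ s f t, (monomial α s f t).1 = x := by
      rintro x (⟨f, rfl⟩ | ⟨s, rfl⟩)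
      · exact ⟨1, f, 1, halg f⟩
      · exact ⟨1, 1, s, hisom s⟩
    rw [Submonoid.closure_le]
    rintro x (hx | hx)
    · exact hgen x hx
    · obtain ⟨s, f, t, hs⟩ := hgen _ hx
      refine ⟨t, star f, s, ?_⟩
      rw [← star_monomial, ← star_star x, ← hs]
      rfl
  have h1 : Subalgebra.toSubmodule (StarAlgebra.adjoin ℂ gen).toSubalgebra
      ≤ P.map (CrossedProduct α).subtype.toAlgHom.toLinearMap := by
    rw [StarAlgebra.adjoin_eq_span, Submodule.span_le]
    intro x hx
    obtain ⟨s, f, t, rfl⟩ := h2 hx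
    exact ⟨_, h s f t, rfl⟩
  refine Submodule.eq_top_iff'.2 fun x => ?_
  have : x ∈ closure (P : Set (CrossedProduct α)) := by
    rw [closure_subtype]
    refine closure_mono ?_ x.2
    intro y hy
    obtain ⟨w, hw, rfl⟩ := h1 hy
    exact ⟨w, hw, rfl⟩
  rwa [hP.closure_eq] at this

end Monomials

/-- The elements `V_m⋆ δ_r V_n` span a dense subspace of the Bost-Connes algebra. -/
theorem eq_top_of_monomial_delta_mem (P : Submodule ℂ CQ) (hP : IsClosed (P : Set CQ))
    (h : ∀ m r n, monomial alpha m (delta r) n ∈ P) : P = ⊤ := by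
  refine eq_top_of_monomial_mem P hP fun m f n => ?_
  have : IsClosed (P : Set CQ) := hP
  have hext := groupCStar_ext (f := P.mkQ ∘ₗ monomialLinear alpha m n) (g := 0)
    (continuous_quot_mk.comp (continuous_monomial m n)) continuous_zero
    fun r => (Submodule.Quotient.mk_eq_zero P).2 (h m r n)
  exact (Submodule.Quotient.mk_eq_zero P).1 (LinearMap.congr_fun hext f)

/-! ### The gauge action -/

/-- The compact group of multiplicative functions `ℕ^× → 𝕋`, with pointwise multiplication and the
topology of pointwise convergence. -/
def gaugeGroup : Subgroup (ℕ+ → Circle) where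
  carrier := {χ | χ 1 = 1 ∧ ∀ m n, χ (m * n) = χ m * χ n}
  mul_mem' := by
    rintro χ ψ ⟨h1, h2⟩ ⟨h3, h4⟩
    exact ⟨by simp [h1, h3], fun m n => by simp [h2, h4, mul_mul_mul_comm]⟩
  one_mem' := ⟨rfl, by simp⟩
  inv_mem' := by
    rintro χ ⟨h1, h2⟩
    exact ⟨by simp [h1], fun m n => by simp [h2, mul_comm]⟩

instance : CompactSpace gaugeGroup := by
  refine isCompact_iff_compactSpace.1 (IsClosed.isCompact ?_)
  change IsClosed {χ : ℕ+ → Circle | χ 1 = 1 ∧ ∀ m n, χ (m * n) = χ m * χ n}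
  simp only [Set.ofPred_and, Set.ofPred_forall]
  refine (isClosed_eq (continuous_apply 1) continuous_const).inter
    (isClosed_iInter fun m => isClosed_iInter fun n => isClosed_eq (continuous_apply _) ?_)
  exact (continuous_apply m).mul (continuous_apply n)

instance : MeasurableSpace gaugeGroup := borel gaugeGroup

instance : BorelSpace gaugeGroup := ⟨rfl⟩

/-- Haar measure on the gauge group. -/
def gaugeMeasure : MeasureTheory.Measure gaugeGroup := MeasureTheory.Measure.haar

instance : gaugeMeasure.IsHaarMeasure := inferInstanceAs (MeasureTheory.Measure.haar).IsHaarMeasure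

theorem continuous_gauge_apply (n : ℕ+) : Continuous fun χ : gaugeGroup => ((χ.1 n : Circle) : ℂ) :=
  continuous_subtype_val.comp ((continuous_apply n).comp continuous_subtype_val)

/-- The functions `n ↦ n ^ (it)` separate the points of `ℕ^×`. -/
theorem exists_gauge_ne {m n : ℕ+} (h : m ≠ n) : ∃ χ : gaugeGroup, χ.1 m ≠ χ.1 n := by
  have hpos : ∀ k : ℕ+, (0 : ℝ) < (k : ℕ) := fun k => by exact_mod_cast k.pos
  have hlog : Real.log (m : ℕ) - Real.log (n : ℕ) ≠ 0 := fun h0 => h <| PNat.coe_injective <| by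
    exact_mod_cast Real.log_injOn_pos (hpos m) (hpos n) (sub_eq_zero.1 h0)
  -- `t` is chosen so that `(m / n) ^ (it) = exp (iπ) = -1`
  let t : ℝ := Real.pi / (Real.log (m : ℕ) - Real.log (n : ℕ))
  refine ⟨⟨fun k => Circle.exp (t * Real.log (k : ℕ)), by simp, fun k l => ?_⟩, fun he => ?_⟩
  · change Circle.exp (t * Real.log ((k * l : ℕ+) : ℕ)) = _
    rw [← Circle.exp_add, PNat.mul_coe, Nat.cast_mul, Real.log_mul (hpos k).ne' (hpos l).ne',
      mul_add]
  · have h1 : Circle.exp Real.pi = 1 := by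
      have : Real.pi = t * Real.log (m : ℕ) - t * Real.log (n : ℕ) := by
        rw [← mul_sub, div_mul_cancel₀ _ hlog]
      rw [this, Circle.exp_sub]
      exact div_eq_one.2 he
    have := congrArg (Subtype.val) h1
    simp at this
    norm_num at this

theorem integral_gauge_of_ne {m n : ℕ+} (h : m ≠ n) :
    ∫ χ : gaugeGroup, star ((χ.1 m : Circle) : ℂ) * (χ.1 n : Circle) ∂gaugeMeasure = 0 := by
  -- translation by `ψ` multiplies the integral by `ψ(m)⁻¹ ψ(n) ≠ 1`
  obtain ⟨ψ, hψ⟩ := exists_gauge_ne h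
  have h1 := MeasureTheory.integral_mul_left_eq_self (μ := gaugeMeasure)
    (fun χ : gaugeGroup => star ((χ.1 m : Circle) : ℂ) * (χ.1 n : Circle)) ψ
  have h2 : ∀ χ : gaugeGroup, star (((ψ * χ).1 m : Circle) : ℂ) * ((ψ * χ).1 n : Circle) =
      (star ((ψ.1 m : Circle) : ℂ) * (ψ.1 n : Circle)) *
        (star ((χ.1 m : Circle) : ℂ) * (χ.1 n : Circle)) := by
    intro χ
    simp only [Subgroup.coe_mul, Pi.mul_apply, Circle.coe_mul, star_mul']
    ring
  simp only [h2, MeasureTheory.integral_const_mul] at h1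
  have h3 : star ((ψ.1 m : Circle) : ℂ) * (ψ.1 n : Circle) ≠ 1 := by
    intro h4
    apply hψ
    have h5 : (ψ.1 m)⁻¹ * ψ.1 n = 1 := Circle.ext (by
      rw [Circle.coe_mul, Circle.coe_inv_eq_conj]; exact h4)
    exact (inv_mul_eq_one.1 h5)
  by_contra h0
  exact h3 (mul_right_cancel₀ h0 (by rw [h1, one_mul]))

section Gauge

universe u

variable {A : Type u} [CStarAlgebra A] {α : ℕ+ →* (A →⋆ₙₐ[ℂ] A)}

/-- The covariant representation `(π, χ V)`. -/
def CovariantRep.gauge (ρ : CovariantRep α) (χ : gaugeGroup) : CovariantRep α where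
  space := ρ.space
  rep := ρ.rep
  isom :=
    { toFun := fun n => ((χ.1 n : Circle) : ℂ) • ρ.isom n
      map_one' := by simp [χ.2.1]
      map_mul' := fun m n => by
        rw [χ.2.2, map_mul, Circle.coe_mul, smul_mul_smul_comm] }
  star_isom_mul_isom n := by
    change star (((χ.1 n : Circle) : ℂ) • ρ.isom n) * (((χ.1 n : Circle) : ℂ) • ρ.isom n) = 1
    rw [star_smul, smul_mul_smul_comm, ρ.star_isom_mul_isom, Complex.star_def, mul_comm,
      Complex.mul_conj, Circle.normSq_coe, Complex.ofReal_one, one_smul]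
  covariant n f := by
    change ρ.rep (α n f) = (((χ.1 n : Circle) : ℂ) • ρ.isom n) * ρ.rep f *
      star (((χ.1 n : Circle) : ℂ) • ρ.isom n)
    rw [star_smul, smul_mul_assoc, smul_mul_smul_comm, Complex.star_def,
      Complex.mul_conj, Circle.normSq_coe, Complex.ofReal_one, one_smul, ρ.covariant]

/-- The representation `π × χ V` on the space of `π × V`. -/
def CovariantRep.gaugeIntegrated (ρ : CovariantRep α) (χ : gaugeGroup) :
    CrossedProduct α →⋆ₐ[ℂ] Op ρ.space := (ρ.gauge χ).integrated

theorem CovariantRep.gaugeIntegrated_monomial (ρ : CovariantRep α) (χ : gaugeGroup) (m n : ℕ+)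
    (f : A) : ρ.gaugeIntegrated χ (monomial α m f n) =
      (star ((χ.1 m : Circle) : ℂ) * (χ.1 n : Circle)) • ρ.integrated (monomial α m f n) := by
  refine ((ρ.gauge χ).integrated_monomial m n f).trans ?_
  change star (((χ.1 m : Circle) : ℂ) • ρ.isom m) * ρ.rep f * (((χ.1 n : Circle) : ℂ) • ρ.isom n) = _
  rw [ρ.integrated_monomial, star_smul, smul_mul_assoc, smul_mul_smul_comm]

theorem CovariantRep.norm_gaugeIntegrated_le (ρ : CovariantRep α) (χ : gaugeGroup)
    (x : CrossedProduct α) : ‖ρ.gaugeIntegrated χ x‖ ≤ ‖x‖ := norm_integrated_le (ρ.gauge χ) x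

theorem CovariantRep.gaugeIntegrated_one (ρ : CovariantRep α) (x : CrossedProduct α) :
    ρ.gaugeIntegrated 1 x = ρ.integrated x := by
  let f : CrossedProduct α →ₗ[ℂ] Op ρ.space := (ρ.gaugeIntegrated 1).toAlgHom.toLinearMap
  let g : CrossedProduct α →ₗ[ℂ] Op ρ.space := ρ.integrated.toAlgHom.toLinearMap
  have hf : Continuous f := (ρ.gauge 1).continuous_integrated
  have hg : Continuous g := ρ.continuous_integrated
  have h : LinearMap.eqLocus f g = ⊤ :=
    eq_top_of_monomial_mem _ (isClosed_eq hf hg) fun m a n => by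
      refine (ρ.gaugeIntegrated_monomial 1 m n a).trans ?_
      simp [g]
  exact (h ▸ Submodule.mem_top : x ∈ LinearMap.eqLocus f g)

/-- The gauge action has norm continuous orbits in every representation. -/
theorem CovariantRep.continuous_gaugeIntegrated (ρ : CovariantRep α) (x : CrossedProduct α) :
    Continuous fun χ => ρ.gaugeIntegrated χ x := by
  -- the elements with continuous orbit form a closed subspace, which contains the monomials
  let P : Submodule ℂ (CrossedProduct α) :=
    { carrier := {x | Continuous fun χ => ρ.gaugeIntegrated χ x}
      add_mem' := fun {x y} hx hy => by
        simp only [Set.mem_ofPred_eq, map_add] at *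
        exact hx.add hy
      zero_mem' := by simpa using continuous_const
      smul_mem' := fun c x hx => by
        simp only [Set.mem_ofPred_eq, map_smul] at *
        exact hx.const_smul c }
  have hP : P = ⊤ := by
    refine eq_top_of_monomial_mem P ?_ fun m f n => ?_
    · refine isClosed_of_closure_subset fun x hx => ?_
      refine continuous_of_uniform_approx_of_continuous fun u hu => ?_
      obtain ⟨ε, hε, hεu⟩ := Metric.mem_uniformity_dist.1 hu
      obtain ⟨y, hy, hxy⟩ := Metric.mem_closure_iff.1 hx ε hε
      refine ⟨_, hy, fun χ => hεu ?_⟩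
      rw [dist_eq_norm, ← map_sub]
      exact (ρ.norm_gaugeIntegrated_le χ _).trans_lt (by rwa [← dist_eq_norm])
    · change Continuous fun χ => ρ.gaugeIntegrated χ (monomial α m f n)
      simp only [ρ.gaugeIntegrated_monomial]
      exact ((continuous_gauge_apply m).star.mul (continuous_gauge_apply n)).smul continuous_const
  exact (hP ▸ Submodule.mem_top : x ∈ P)

variable (ρ : CovariantRep α) (ξ : ρ.space.carrier)

theorem CovariantRep.continuous_integrand (x : CrossedProduct α) :
    Continuous fun χ => inner ℂ ξ (ρ.gaugeIntegrated χ x ξ) :=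
  continuous_const.inner ((ρ.continuous_gaugeIntegrated x).clm_apply continuous_const)

theorem CovariantRep.integrable_integrand (x : CrossedProduct α) :
    MeasureTheory.Integrable (fun χ => inner ℂ ξ (ρ.gaugeIntegrated χ x ξ)) gaugeMeasure :=
  (ρ.continuous_integrand ξ x).integrable_of_hasCompactSupport (HasCompactSupport.of_compactSpace _)

/-- The vector functional `x ↦ ⟨ξ, (π × χ V)(x) ξ⟩` averaged over the gauge group. Haar measure is
not normalized, so the total mass of the group appears as a factor in its values. -/
def CovariantRep.averageLinear : CrossedProduct α →ₗ[ℂ] ℂ where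
  toFun x := ∫ χ, inner ℂ ξ (ρ.gaugeIntegrated χ x ξ) ∂gaugeMeasure
  map_add' x y := by
    simp only [map_add, add_apply, inner_add_right]
    exact MeasureTheory.integral_add (ρ.integrable_integrand ξ x) (ρ.integrable_integrand ξ y)
  map_smul' c x := by
    simp only [map_smul, smul_apply, inner_smul_right]
    exact MeasureTheory.integral_const_mul _ _

theorem CovariantRep.continuous_averageLinear : Continuous (ρ.averageLinear ξ) := by
  refine AddMonoidHomClass.continuous_of_bound (ρ.averageLinear ξ)
    (‖ξ‖ * ‖ξ‖ * gaugeMeasure.real Set.univ) fun x => ?_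
  refine (MeasureTheory.norm_integral_le_of_norm_le_const (C := ‖ξ‖ * (‖x‖ * ‖ξ‖))
    (Filter.Eventually.of_forall fun χ => ?_)).trans_eq (by ring)
  refine (norm_inner_le_norm _ _).trans ?_
  gcongr
  exact ((ρ.gaugeIntegrated χ x).le_opNorm ξ).trans
    (by gcongr; exact ρ.norm_gaugeIntegrated_le χ x)

theorem CovariantRep.averageLinear_monomial_of_ne {m n : ℕ+} (h : m ≠ n) (f : A) :
    ρ.averageLinear ξ (monomial α m f n) = 0 := by
  change ∫ χ, inner ℂ ξ (ρ.gaugeIntegrated χ (monomial α m f n) ξ) ∂gaugeMeasure = 0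
  simp only [ρ.gaugeIntegrated_monomial, smul_apply, inner_smul_right]
  rw [MeasureTheory.integral_mul_const, integral_gauge_of_ne h, zero_mul]

theorem CovariantRep.averageLinear_monomial_self (n : ℕ+) (f : A) :
    ρ.averageLinear ξ (monomial α n f n) =
      gaugeMeasure.real Set.univ * inner ℂ ξ (ρ.integrated (monomial α n f n) ξ) := by
  have h : ∀ χ : gaugeGroup, star ((χ.1 n : Circle) : ℂ) * (χ.1 n : Circle) = 1 := fun χ => by
    rw [mul_comm, Complex.star_def, Complex.mul_conj, Circle.normSq_coe, Complex.ofReal_one]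
  change ∫ χ, inner ℂ ξ (ρ.gaugeIntegrated χ (monomial α n f n) ξ) ∂gaugeMeasure = _
  simp only [ρ.gaugeIntegrated_monomial, h, one_smul, MeasureTheory.integral_const]
  simp

/-- The average over the gauge group is faithful: the integrand is continuous and nonnegative, and
Haar measure charges every neighbourhood of the identity. -/
theorem CovariantRep.apply_eq_zero_of_averageLinear_eq_zero (x : CrossedProduct α)
    (h : ρ.averageLinear ξ (star x * x) = 0) : ρ.integrated x ξ = 0 := by
  have hg : ∀ χ, inner ℂ ξ (ρ.gaugeIntegrated χ (star x * x) ξ) =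
      ((‖ρ.gaugeIntegrated χ x ξ‖ ^ 2 : ℝ) : ℂ) := fun χ => by
    rw [map_mul, map_star]
    change inner ℂ ξ ((ρ.gaugeIntegrated χ x).adjoint (ρ.gaugeIntegrated χ x ξ)) = _
    rw [ContinuousLinearMap.adjoint_inner_right, inner_self_eq_norm_sq_to_K]
    push_cast
    rfl
  have hc : Continuous fun χ => ‖ρ.gaugeIntegrated χ x ξ‖ ^ 2 :=
    ((ρ.continuous_gaugeIntegrated x).clm_apply continuous_const).norm.pow 2
  have h0 : ∫ χ, ‖ρ.gaugeIntegrated χ x ξ‖ ^ 2 ∂gaugeMeasure = 0 := by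
    change ∫ χ, inner ℂ ξ (ρ.gaugeIntegrated χ (star x * x) ξ) ∂gaugeMeasure = 0 at h
    simp only [hg] at h
    rw [integral_complex_ofReal] at h
    exact_mod_cast h
  by_contra hne
  refine (hc.integral_pos_of_hasCompactSupport_nonneg_nonzero (μ := gaugeMeasure)
    (HasCompactSupport.of_compactSpace _) (fun χ => by positivity) (x := 1) ?_).ne' h0
  rw [ρ.gaugeIntegrated_one]
  exact pow_ne_zero 2 (norm_ne_zero_iff.2 hne)

end Gauge

/-! ### Arithmetic of `𝒵` -/

theorem isUnit_natCast_of_ne {p : ℕ} (hp : p.Prime) {q : Nat.Primes} (hq : (q : ℕ) ≠ p) :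
    IsUnit ((p : ℕ) : ℤ_[(q : ℕ)]) := by
  rw [PadicInt.isUnit_iff]
  have : ((p : ℕ) : ℤ_[(q : ℕ)]) = ((p : ℤ) : ℤ_[(q : ℕ)]) := by simp
  rw [this]
  refine le_antisymm (PadicInt.norm_le_one _) (not_lt.1 fun hlt => hq ?_)
  rw [PadicInt.norm_int_lt_one_iff_dvd] at hlt
  exact (Nat.prime_dvd_prime_iff_eq q.2 hp).1 (by exact_mod_cast hlt)

/-- Divisibility by a prime power in `𝒵` is decided in a single coordinate. -/
theorem prime_pow_dvd_iff (p : Nat.Primes) (k : ℕ) (z : ZHat) :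
    (((p : ℕ) ^ k : ℕ) : ZHat) ∣ z ↔ (((p : ℕ) ^ k : ℕ) : ℤ_[(p : ℕ)]) ∣ z p := by
  refine pi_dvd_iff.trans ⟨fun h => h p, fun h q => ?_⟩
  by_cases hq : q = p
  · subst hq
    exact h
  · rw [Pi.natCast_apply, Nat.cast_pow]
    exact ((isUnit_natCast_of_ne p.2 fun h => hq (Subtype.ext h)).pow k).dvd

theorem natCast_apply_ne_zero {n : ℕ} (hn : 0 < n) (p : Nat.Primes) :
    ((n : ZHat) p) ≠ 0 := by
  rw [Pi.natCast_apply]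
  exact_mod_cast hn.ne'

theorem natCast_mul_left_cancel {n : ℕ} (hn : 0 < n) {z w : ZHat}
    (h : (n : ZHat) * z = n * w) : z = w :=
  funext fun p => mul_left_cancel₀ (natCast_apply_ne_zero hn p) (congrFun h p)

/-- A positive integer can be split off from `a` so that the quotient is a unit at finitely many
prescribed primes. -/
theorem exists_eq_natCast_mul (a : ZHat) (F : Finset Nat.Primes) (ha : ∀ p ∈ F, a p ≠ 0) :
    ∃ (d : ℕ) (w : ZHat), 0 < d ∧ a = d * w ∧ ∀ p ∈ F, IsUnit (w p) := by
  classical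
  induction F using Finset.induction_on with
  | empty => exact ⟨1, a, one_pos, by simp, by simp⟩
  | insert p F hp ih =>
    obtain ⟨d, w, hd, rfl, hw⟩ := ih fun q hq => ha q (Finset.mem_insert_of_mem hq)
    have hwp : w p ≠ 0 := right_ne_zero_of_mul (ha p (Finset.mem_insert_self p F))
    have hs := PadicInt.unitCoeff_spec hwp
    obtain ⟨v, hv⟩ : (((p : ℕ) ^ (w p).valuation : ℕ) : ZHat) ∣ w := by
      rw [prime_pow_dvd_iff]
      exact ⟨_, by rw [mul_comm, Nat.cast_pow]; exact hs⟩
    have hpos : 0 < (p : ℕ) ^ (w p).valuation := pow_pos p.2.pos _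
    refine ⟨d * (p : ℕ) ^ (w p).valuation, v, Nat.mul_pos hd hpos, ?_, ?_⟩
    · rw [Nat.cast_mul, mul_assoc, ← hv]
    · intro q hq
      rcases Finset.mem_insert.1 hq with rfl | hq
      · have h1 : w q = _ := congrFun hv q
        have h2 : v q = (PadicInt.unitCoeff hwp : ℤ_[(q : ℕ)]) := by
          refine mul_left_cancel₀ (natCast_apply_ne_zero hpos q) (h1.symm.trans (hs.trans ?_))
          rw [Pi.natCast_apply, Nat.cast_pow, mul_comm]
        rw [h2]
        exact Units.isUnit _
      · have h1 := hw q hq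
        rw [hv] at h1
        exact (IsUnit.mul_iff.1 h1).2

theorem Index.point_one (a : ZHat) : (Index.one a).point = a :=
  funext fun p => Subtype.ext (by simp [Index.point, Index.one])

/-- If no coordinate of `a` vanishes then the multiples `r a` in `𝒵`, with `r` a positive rational
number, are dense in `𝒵`. -/
theorem exists_index_point_dvd_sub {a : ZHat} (ha : ∀ p, a p ≠ 0) (n : ℕ) (hn : 0 < n) (k : ℤ) :
    ∃ r : Index a, (n : ZHat) ∣ r.point - k := by
  classical
  let F : Finset Nat.Primes :=
    n.primeFactors.attach.image fun p => ⟨p.1, Nat.prime_of_mem_primeFactors p.2⟩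
  obtain ⟨d, w, hd, hw, hu⟩ := exists_eq_natCast_mul a F fun p _ => ha p
  obtain ⟨j, hj⟩ := exists_dvd_sub n hn w
  -- `w` is a unit at the primes dividing `n`, hence so is its residue `j` modulo `n`
  have hcop : IsCoprime j (n : ℤ) := by
    rw [Int.isCoprime_iff_gcd_eq_one]
    by_contra hne
    obtain ⟨p, hpd⟩ : ∃ p : Nat.Primes, (p : ℕ) ∣ j.gcd n := by
      obtain ⟨p, hp, hpd⟩ := Nat.exists_prime_and_dvd hne
      exact ⟨⟨p, hp⟩, hpd⟩
    have hpj : ((p : ℕ) : ℤ) ∣ j := (Int.natCast_dvd_natCast.2 hpd).trans (Int.gcd_dvd_left ..)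
    have hpn : (p : ℕ) ∣ n := by
      exact_mod_cast (Int.natCast_dvd_natCast.2 hpd).trans (Int.gcd_dvd_right ..)
    have hpF := hu p (Finset.mem_image.2
      ⟨⟨p, Nat.mem_primeFactors.2 ⟨p.2, hpn, hn.ne'⟩⟩, Finset.mem_attach _ _, rfl⟩)
    have h1 : ((p : ℕ) : ZHat) ∣ w := by
      have h2 : ((p : ℕ) : ZHat) ∣ (j : ZHat) := by
        have := map_dvd (Int.castRingHom ZHat) hpj
        simpa using this
      exact (dvd_sub_left h2).1 ((Nat.cast_dvd_cast hpn).trans hj)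
    exact PadicInt.prime_p.not_isUnit (isUnit_of_dvd_unit (pi_dvd_iff.1 h1 p) hpF)
  obtain ⟨x, y, hxy⟩ := hcop
  -- a positive representative of the residue class of `k x`
  obtain ⟨m, hm⟩ : ∃ m : ℕ+, (n : ℤ) ∣ (m : ℕ) - k * x := by
    have hn' : (0 : ℤ) < n := by exact_mod_cast hn
    have h0 := Int.emod_nonneg (k * x) hn'.ne'
    refine ⟨⟨(k * x % n).toNat + n, by omega⟩, ?_⟩
    rw [PNat.mk_coe, Nat.cast_add, Int.toNat_of_nonneg h0]
    have := Int.emod_add_mul_ediv (k * x) n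
    exact ⟨1 - k * x / n, by linear_combination this⟩
  have hpt : (Index.mul m (Index.one a)).point = (m : ℕ) * a := by
    rw [Index.point_mul, Index.point_one]
  obtain ⟨r, hr⟩ := Index.exists_of_dvd ⟨d, hd⟩ (Index.mul m (Index.one a))
    (by rw [hpt, hw]; exact ⟨(m : ℕ) * w, by simp; ring⟩)
  refine ⟨r, ?_⟩
  have hrp : r.point = (m : ℕ) * w := by
    apply natCast_mul_left_cancel hd
    have h1 := Index.point_mul ⟨d, hd⟩ r
    rw [hr, hpt, PNat.mk_coe] at h1
    rw [← h1]
    nth_rewrite 1 [hw]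
    ring
  obtain ⟨c, hc⟩ := hj
  obtain ⟨e, he⟩ := hm
  refine ⟨(m : ℕ) * c + e * j - k * y, ?_⟩
  have he' : (((m : ℕ) : ZHat) - k * x) = n * e := by
    exact_mod_cast congrArg (Int.cast : ℤ → ZHat) he
  have hxy' : ((x * j + y * n : ZHat)) = 1 := by exact_mod_cast congrArg (Int.cast : ℤ → ZHat) hxy
  rw [hrp]
  linear_combination (m : ℕ) * hc + j * he' + k * hxy'

theorem mem_nonZeroDivisors_iff (a : ZHat) :
    a ∈ nonZeroDivisors ZHat ↔ ∀ p : Nat.Primes, a p ≠ 0 := by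
  classical
  rw [mem_nonZeroDivisors_iff_right]
  constructor
  · intro h p hp
    have := congrFun (h (Pi.single p 1) (by
      funext q
      by_cases hq : q = p
      · subst hq; simp [hp]
      · simp [hq])) p
    simp at this
  · intro h x hx
    funext p
    exact (mul_eq_zero.1 (congrFun hx p)).resolve_right (h p)

/-! ### Points of `𝒵` as characters of `ℚ/ℤ` -/

theorem act_eq_of_dvd_sub {n : ℕ} {r : QZ} (hr : n • r = 0) {z w : ZHat}
    (h : (n : ZHat) ∣ z - w) : act z r = act w r := by
  rcases n.eq_zero_or_pos with rfl | hn
  · rw [Nat.cast_zero, zero_dvd_iff, sub_eq_zero] at h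
    rw [h]
  obtain ⟨m, hm⟩ := exists_dvd_sub n hn w
  rw [act_eq hr hm, act_eq (z := z) hr]
  have := dvd_add h hm
  rwa [sub_add_sub_cancel] at this

theorem expQZ_injective : Function.Injective expQZ :=
  (injective_iff_map_eq_zero expQZ).2 fun _ => expQZ_eq_zero

theorem character_eq_iff {z w : ZHat} {r : QZ} :
    character z (.ofAdd r) = character w (.ofAdd r) ↔ act z r = act w r := by
  change (expQZ (act z r)).toMul = (expQZ (act w r)).toMul ↔ _
  rw [Additive.toMul.injective.eq_iff, expQZ_injective.eq_iff]

theorem nsmul_mk_one_div {n : ℕ} (hn : 0 < n) : n • (((1 / n : ℚ)) : QZ) = 0 := by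
  rw [← QuotientAddGroup.mk_nsmul, QZ.mk_eq_zero_iff]
  have : (n : ℚ) ≠ 0 := by exact_mod_cast hn.ne'
  exact ⟨1, by rw [nsmul_eq_mul]; field_simp; simp⟩

theorem zsmul_mk_one_div_eq_zero_iff {n : ℕ} (hn : 0 < n) (m : ℤ) :
    m • (((1 / n : ℚ)) : QZ) = 0 ↔ (n : ℤ) ∣ m := by
  have : (n : ℚ) ≠ 0 := by exact_mod_cast hn.ne'
  rw [← QuotientAddGroup.mk_zsmul, QZ.mk_eq_zero_iff]
  constructor
  · rintro ⟨k, hk⟩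
    rw [zsmul_eq_mul] at hk
    field_simp at hk
    exact ⟨k, by exact_mod_cast (hk.symm.trans (mul_comm _ _))⟩
  · rintro ⟨k, rfl⟩
    exact ⟨k, by rw [zsmul_eq_mul]; push_cast; field_simp⟩

/-- A point of `𝒵` is determined by its character. -/
theorem eq_of_character_eq {z w : ZHat}
    (h : ∀ r : QZ, character z (.ofAdd r) = character w (.ofAdd r)) : z = w := by
  have hdvd : ∀ n : ℕ, 0 < n → (n : ZHat) ∣ z - w := by
    intro n hn
    obtain ⟨m, hm⟩ := exists_dvd_sub n hn z
    obtain ⟨l, hl⟩ := exists_dvd_sub n hn w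
    have h1 := character_eq_iff.1 (h ((1 / n : ℚ) : QZ))
    rw [act_eq (nsmul_mk_one_div hn) hm, act_eq (nsmul_mk_one_div hn) hl, ← sub_eq_zero,
      ← sub_smul, zsmul_mk_one_div_eq_zero_iff hn] at h1
    have h2 := map_dvd (Int.castRingHom ZHat) h1
    simp only [map_natCast, map_sub, eq_intCast] at h2
    have h3 := dvd_add (dvd_sub hm hl) h2
    rwa [show z - m - (w - l) + (m - l) = z - w by ring] at h3
  funext p
  refine sub_eq_zero.1 ?_
  rw [← Pi.sub_apply]
  refine PadicInt.ext_of_toZModPow.1 fun k => ?_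
  rw [map_zero, ← RingHom.mem_ker, PadicInt.ker_toZModPow, Ideal.mem_span_singleton]
  have := (prime_pow_dvd_iff p k _).1 (hdvd ((p : ℕ) ^ k) (pow_pos p.2.pos k))
  rwa [Nat.cast_pow] at this

/-! ### The norm of `C⋆(ℚ/ℤ)` -/

theorem groupCStar_mul_comm {G : Type} [CommGroup G] (f g : GroupCStar G) : f * g = g * f := by
  have h1 : ∀ (x : G) (g : GroupCStar G), delta x * g = g * delta x := fun x g =>
    LinearMap.congr_fun (groupCStar_ext (f := LinearMap.mulLeft ℂ (delta x))
      (g := LinearMap.mulRight ℂ (delta x)) (continuous_const_mul _) (continuous_mul_const _)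
      fun y => by
        rw [LinearMap.mulLeft_apply, LinearMap.mulRight_apply, ← delta_mul, ← delta_mul,
          mul_comm]) g
  exact LinearMap.congr_fun (groupCStar_ext (f := LinearMap.mulRight ℂ g)
    (g := LinearMap.mulLeft ℂ g) (continuous_mul_const _) (continuous_const_mul _)
    fun x => h1 x g) f

/-- The C⋆-algebra of an abelian group is commutative. -/
abbrev groupCStarCommCStarAlgebra (G : Type) [CommGroup G] : CommCStarAlgebra (GroupCStar G) where
  mul_comm := groupCStar_mul_comm

/-- The map `g ↦ δ_g` as a homomorphism of monoids. -/
def deltaHom (G : Type) [Group G] : G →* GroupCStar G where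
  toFun := delta
  map_one' := delta_one
  map_mul' := delta_mul

/-- The group algebra of the subgroup `n⁻¹ℤ/ℤ` of `ℚ/ℤ`. -/
def deltaSpan (n : ℕ) : Submodule ℂ CStarQZ :=
  Submodule.span ℂ ((fun r : QZ => (delta (.ofAdd r) : CStarQZ)) '' {r | n • r = 0})

theorem deltaSpan_mono {m n : ℕ} (h : m ∣ n) : deltaSpan m ≤ deltaSpan n := by
  obtain ⟨k, rfl⟩ := h
  refine Submodule.span_mono (Set.image_mono fun r (hr : m • r = 0) => ?_)
  change (m * k) • r = 0
  rw [mul_comm, mul_smul, hr, smul_zero]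

theorem fourier_eq_of_dvd_sub {n : ℕ} {f : CStarQZ} (hf : f ∈ deltaSpan n) {z w : ZHat}
    (h : (n : ZHat) ∣ z - w) : fourier f z = fourier f w := by
  refine LinearMap.eqOn_span (f := fourierLinear z) (g := fourierLinear w) ?_ hf
  rintro _ ⟨r, hr, rfl⟩
  exact (fourier_delta r z).trans <| (congrArg _ (character_eq_iff.2
    (act_eq_of_dvd_sub hr h))).trans (fourier_delta r w).symm

theorem character_natCast_one_div {n : ℕ} (hn : 0 < n) (k : ℕ) :
    (character (k : ZHat) (.ofAdd ((1 / n : ℚ) : QZ)) : ℂ) =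
      Complex.exp (2 * Real.pi * Complex.I / n) ^ k := by
  have hn' : (n : ℂ) ≠ 0 := by exact_mod_cast hn.ne'
  have h1 : act (k : ZHat) ((1 / n : ℚ) : QZ) = (((k : ℤ) • (1 / n : ℚ) : ℚ) : QZ) := by
    rw [act_eq (nsmul_mk_one_div hn) (m := k) (by simp), ← QuotientAddGroup.mk_zsmul]
  change (((expQZ (act (k : ZHat) ((1 / n : ℚ) : QZ))).toMul : Circle) : ℂ) = _
  rw [h1, expQZ_mk, toMul_ofMul, Circle.coe_exp, ← Complex.exp_nat_mul]
  congr 1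
  simp only [zsmul_eq_mul]
  push_cast
  field_simp

theorem exists_eq_nsmul {n : ℕ} (hn : 0 < n) {r : QZ} (hr : n • r = 0) :
    ∃ j : ℕ, r = j • ((1 / n : ℚ) : QZ) := by
  obtain ⟨j, -, rfl⟩ := Finset.mem_image.1
    (Finset.mem_coe.1 ((divisors_aux ⟨n, hn⟩ 0).subset hr))
  refine ⟨j, ?_⟩
  rw [← QuotientAddGroup.mk_nsmul]
  congr 1
  rw [nsmul_eq_mul, PNat.mk_coe]
  ring

/-- Every character of the group algebra of `n⁻¹ℤ/ℤ` is evaluation of the Fourier transform at an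
integer: it maps `δ_{1/n}` to an `n`-th root of unity. -/
theorem exists_algHom_eq_fourier {n : ℕ} (hn : 0 < n) (φ : CStarQZ →ₐ[ℂ] ℂ) :
    ∃ k : ℤ, ∀ f ∈ deltaSpan n, φ f = fourier f k := by
  set t : QZ := ((1 / n : ℚ) : QZ) with ht
  have hroot : φ (deltaHom _ (.ofAdd t)) ^ n = 1 := by
    rw [← map_pow, ← map_pow, ← ofAdd_nsmul, nsmul_mk_one_div hn, ofAdd_zero, map_one, map_one]
  have : NeZero n := ⟨hn.ne'⟩
  obtain ⟨k, -, hk⟩ := (Complex.isPrimitiveRoot_exp n hn.ne').eq_pow_of_pow_eq_one hroot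
  refine ⟨k, fun f hf => ?_⟩
  refine LinearMap.eqOn_span (f := φ.toLinearMap) (g := fourierLinear (k : ℤ)) ?_ hf
  rintro _ ⟨r, hr, rfl⟩
  obtain ⟨j, rfl⟩ := exists_eq_nsmul hn hr
  change φ (deltaHom _ (.ofAdd (j • t))) = fourier (delta (.ofAdd (j • t))) _
  rw [fourier_delta, ofAdd_nsmul, map_pow, map_pow, map_pow, Circle.coe_pow, Int.cast_natCast,
    character_natCast_one_div hn, hk]

/-- The norm of an element of the group algebra of `n⁻¹ℤ/ℤ` is the supremum of its Fourier transform
over the dense subset `ℤ` of `𝒵`, by Gelfand duality. -/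
theorem norm_le_of_fourier_le {n : ℕ} (hn : 0 < n) {f : CStarQZ} (hf : f ∈ deltaSpan n) {C : ℝ}
    (h : ∀ k : ℤ, ‖fourier f k‖ ≤ C) : ‖f‖ ≤ C := by
  let := groupCStarCommCStarAlgebra (Multiplicative QZ)
  rw [← (AddMonoidHomClass.isometry_iff_norm _).1
    (gelfandTransform_isometry CStarQZ) f]
  refine (ContinuousMap.norm_le _ ((norm_nonneg _).trans (h 0))).2 fun φ => ?_
  obtain ⟨k, hk⟩ := exists_algHom_eq_fourier hn (WeakDual.CharacterSpace.toAlgHom φ)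
  refine le_trans (le_of_eq ?_) (h k)
  rw [← hk f hf]
  rfl

/-! ### The conditional expectation onto `C⋆(ℚ/ℤ)` -/

/-- The solutions `s` of `n s = n r` form the coset `r + {u : n u = 0}`, so `δ_r` factors out of the
average: `αₙ(δ_{nr}) = δ_r αₙ(1)`. -/
theorem alpha_delta_nsmul (n : ℕ+) (r : QZ) :
    alpha n (delta (.ofAdd ((n : ℕ) • r))) = delta (.ofAdd r) * alpha n 1 := by
  change alphaEnd n _ = _ * alphaEnd n 1
  rw [← delta_one, ← ofAdd_zero, alphaEnd_delta, alphaEnd_delta, mul_smul_comm, Finset.mul_sum]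
  congr 1
  have h := sum_divisors_add n (s := r) (t := 0) rfl fun s => (delta (.ofAdd s) : CStarQZ)
  rw [add_zero] at h
  rw [← h]
  simp only [ofAdd_add, delta_mul]

/-- The relation `V_n⋆ δ_r V_n = δ_{nr}`, by which diagonal monomials lie in `C⋆(ℚ/ℤ)`. -/
theorem CovariantRep.integrated_monomial_delta (ρ : CovariantRep alpha) (n : ℕ+) (r : QZ) :
    ρ.integrated (monomial alpha n (delta (.ofAdd r)) n) =
      ρ.rep (delta (.ofAdd ((n : ℕ) • r))) := by
  rw [ρ.integrated_monomial]
  have h1 := ρ.isom_mul_rep n (delta (.ofAdd ((n : ℕ) • r)))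
  have h2 : ρ.rep (alpha n 1) = ρ.isom n * star (ρ.isom n) := by
    rw [ρ.covariant, map_one, mul_one]
  rw [alpha_delta_nsmul, map_mul, h2, mul_assoc, mul_assoc (ρ.isom n), ρ.star_isom_mul_isom,
    mul_one] at h1
  rw [mul_assoc, ← h1, ← mul_assoc, ρ.star_isom_mul_isom, one_mul]

theorem inner_basisVec {a : ZHat} (r s : Index a) :
    inner ℂ (basisVec r) (basisVec s) = if r = s then (1 : ℂ) else 0 :=
  orthonormal_iff_ite.1 (orthonormal_basisVec a) r s

theorem piV_monomial (a : ZHat) (m n : ℕ+) (f : CStarQZ) :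
    piV a (monomial alpha m f n) = star (isomOp a m) * diagOp a f * isomOp a n :=
  (covariantRep a).integrated_monomial m n f

/-- Off-diagonal monomials have no diagonal coefficients, because `m r ≠ n r` for `m ≠ n`. -/
theorem inner_piV_monomial_of_ne (a : ZHat) {m n : ℕ+} (h : m ≠ n) (f : CStarQZ) (r : Index a) :
    inner ℂ (basisVec r) (piV a (monomial alpha m f n) (basisVec r)) = (0 : ℂ) := by
  rw [piV_monomial]
  change inner ℂ (basisVec r) ((isomOp a m).adjoint (diagOp a f (isomOp a n (basisVec r)))) = _
  rw [ContinuousLinearMap.adjoint_inner_right, isomOp_basisVec, isomOp_basisVec, diagOp_basisVec,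
    inner_smul_right, inner_basisVec, if_neg, mul_zero]
  intro he
  have h1 := mul_right_cancel₀ r.2.1.ne' (congrArg Subtype.val he)
  exact h (PNat.coe_injective (by exact_mod_cast h1))

set_option maxHeartbeats 600000 in
/-- On the span of the elements `V_m⋆ δ_r V_n` there is a conditional expectation `y ↦ f` onto the
group algebra, which computes both the average over the gauge group and the diagonal coefficients
of the representations `π_a × V`. -/
theorem exists_expectation {y : CQ}
    (hy : y ∈ Submodule.span ℂ {x | ∃ m r n, x = monomial alpha m (delta r) n}) :
    ∃ n : ℕ, 0 < n ∧ ∃ f ∈ deltaSpan n,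
      (∀ (ρ : CovariantRep alpha) (ξ : ρ.space.carrier),
        ρ.averageLinear ξ y = gaugeMeasure.real Set.univ * inner ℂ ξ (ρ.rep f ξ)) ∧
      ∀ (a : ZHat) (r : Index a),
        inner ℂ (basisVec r) (piV a y (basisVec r)) = fourier f r.point := by
  induction hy using Submodule.span_induction with
  | mem x hx =>
    obtain ⟨m, r, n, rfl⟩ := hx
    by_cases hmn : m = n
    · subst hmn
      refine ⟨addOrderOf ((m : ℕ) • r.toAdd), QZ.isOfFinAddOrder _,
        delta (.ofAdd ((m : ℕ) • r.toAdd)),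
        Submodule.subset_span ⟨_, addOrderOf_nsmul_eq_zero _, rfl⟩, fun ρ ξ => ?_, fun a s => ?_⟩
      · rw [ρ.averageLinear_monomial_self]
        exact congrArg (fun T : Op ρ.space => _ * inner ℂ ξ (T ξ))
          (ρ.integrated_monomial_delta m r.toAdd)
      · have h : piV a (monomial alpha m (delta r) m) = diagOp a _ :=
          (covariantRep a).integrated_monomial_delta m r.toAdd
        rw [h, diagOp_basisVec, inner_smul_right, inner_basisVec, if_pos rfl, mul_one]
    · refine ⟨1, one_pos, 0, Submodule.zero_mem _, fun ρ ξ => ?_, fun a s => ?_⟩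
      · rw [ρ.averageLinear_monomial_of_ne ξ hmn, map_zero, zero_apply, inner_zero_right, mul_zero]
      · rw [inner_piV_monomial_of_ne a hmn]
        exact (map_zero (fourierLinear s.point)).symm
  | zero =>
    refine ⟨1, one_pos, 0, Submodule.zero_mem _, fun ρ ξ => ?_, fun a s => ?_⟩
    · rw [map_zero, map_zero, zero_apply, inner_zero_right, mul_zero]
    · rw [map_zero, zero_apply, inner_zero_right]
      exact (map_zero (fourierLinear s.point)).symm
  | add x y _ _ hx hy =>
    obtain ⟨m, hm, f, hf, hf1, hf2⟩ := hx
    obtain ⟨n, hn, g, hg, hg1, hg2⟩ := hy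
    refine ⟨m * n, Nat.mul_pos hm hn, f + g, Submodule.add_mem _
      (deltaSpan_mono (Dvd.intro _ rfl) hf) (deltaSpan_mono (Dvd.intro_left _ rfl) hg),
      fun ρ ξ => ?_, fun a s => ?_⟩
    · rw [map_add, hf1, hg1, map_add, add_apply, inner_add_right, mul_add]
    · rw [map_add, add_apply, inner_add_right, hf2, hg2]
      exact (map_add (fourierLinear s.point) f g).symm
  | smul c x _ hx =>
    obtain ⟨n, hn, f, hf, hf1, hf2⟩ := hx
    refine ⟨n, hn, c • f, Submodule.smul_mem _ c hf, fun ρ ξ => ?_, fun a s => ?_⟩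
    · rw [map_smul, hf1, map_smul, smul_apply, inner_smul_right, smul_eq_mul, mul_left_comm]
    · rw [map_smul, smul_apply, inner_smul_right, hf2]
      exact (map_smul (fourierLinear s.point) c f).symm

/-! ### Faithfulness -/

set_option maxHeartbeats 600000 in
/-- If no coordinate of `a` vanishes, then averaged vector functionals of all covariant
representations are dominated by the norm of `π_a × V`. -/
theorem norm_averageLinear_le {a : ZHat} (ha : ∀ p, a p ≠ 0) (ρ : CovariantRep alpha)
    (ξ : ρ.space.carrier) (y : CQ) :
    ‖ρ.averageLinear ξ y‖ ≤ gaugeMeasure.real Set.univ * (‖ξ‖ * (‖piV a y‖ * ‖ξ‖)) := by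
  set P := (Submodule.span ℂ {x : CQ | ∃ m r n, x = monomial alpha m (delta r) n})
  have hP : P.topologicalClosure = ⊤ := eq_top_of_monomial_delta_mem _
    P.isClosed_topologicalClosure fun m r n =>
      P.le_topologicalClosure (Submodule.subset_span ⟨m, r, n, rfl⟩)
  have hy : y ∈ closure (P : Set CQ) := (hP ▸ Submodule.mem_top : y ∈ P.topologicalClosure)
  have hc : Continuous (piV a) := (covariantRep a).continuous_integrated
  refine closure_minimal (s := (P : Set CQ)) (t := {y | ‖ρ.averageLinear ξ y‖ ≤
    gaugeMeasure.real Set.univ * (‖ξ‖ * (‖piV a y‖ * ‖ξ‖))}) ?_ (isClosed_le ?_ ?_) hy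
  · intro x hx
    obtain ⟨n, hn, f, hf, hf1, hf2⟩ := exists_expectation hx
    have hnorm : ‖f‖ ≤ ‖piV a x‖ := by
      refine norm_le_of_fourier_le hn hf fun k => ?_
      obtain ⟨r, hr⟩ := exists_index_point_dvd_sub ha n hn k
      have h1 : ‖basisVec r‖ = 1 := (orthonormal_basisVec a).1 r
      rw [← fourier_eq_of_dvd_sub hf hr, ← hf2 a r]
      refine (norm_inner_le_norm _ _).trans ?_
      rw [h1, one_mul]
      exact ((piV a x).le_opNorm _).trans_eq (by rw [h1, mul_one])
    have h1 : ‖ρ.rep f ξ‖ ≤ ‖piV a x‖ * ‖ξ‖ := ((ρ.rep f).le_opNorm ξ).trans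
      (mul_le_mul_of_nonneg_right ((NonUnitalStarAlgHom.norm_apply_le ρ.rep f).trans hnorm)
        (norm_nonneg ξ))
    have h2 : ‖inner ℂ ξ (ρ.rep f ξ)‖ ≤ ‖ξ‖ * (‖piV a x‖ * ‖ξ‖) :=
      (norm_inner_le_norm _ _).trans (mul_le_mul_of_nonneg_left h1 (norm_nonneg ξ))
    refine (congrArg norm (hf1 ρ ξ)).trans_le ((norm_mul _ _).trans_le ?_)
    exact mul_le_mul (Complex.norm_of_nonneg MeasureTheory.measureReal_nonneg).le h2
      (norm_nonneg _) MeasureTheory.measureReal_nonneg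
  · exact (ρ.continuous_averageLinear ξ).norm
  · exact continuous_const.mul (continuous_const.mul (hc.norm.mul continuous_const))

theorem piV_injective {a : ZHat} (ha : ∀ p, a p ≠ 0) : Function.Injective (piV a) := by
  refine (injective_iff_map_eq_zero (piV a)).2 fun x hx => crossedProduct_ext fun ρ => ?_
  refine ContinuousLinearMap.ext fun ξ => ?_
  rw [map_zero]
  refine ρ.apply_eq_zero_of_averageLinear_eq_zero ξ x (norm_le_zero_iff.1 ?_)
  refine (norm_averageLinear_le ha ρ ξ (star x * x)).trans_eq ?_
  rw [map_mul, hx, mul_zero, norm_zero, zero_mul, mul_zero, mul_zero]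

/-- If `a_p = 0` then `π_a` does not distinguish `δ_{1/p}` from `1`, whereas the representation with
`a = 1` does. -/
theorem ne_zero_of_piV_injective {a : ZHat} (h : Function.Injective (piV a)) (p : Nat.Primes) :
    a p ≠ 0 := by
  intro hp
  have hpos := p.2.pos
  set t : QZ := ((1 / (p : ℕ) : ℚ) : QZ)
  have ht : (p : ℕ) • t = 0 := nsmul_mk_one_div hpos
  have h1 : crossedAlg alpha (delta (.ofAdd t)) = 1 := by
    apply h
    rw [map_one]
    refine ellTwo_ext fun r => ?_
    change diagOp a (delta (.ofAdd t)) (basisVec r) = basisVec r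
    have hdvd : ((p : ℕ) : ZHat) ∣ r.point - (0 : ℤ) := by
      have := (prime_pow_dvd_iff p 1 r.point).2 (by
        have : r.point p = 0 := Subtype.ext (by simp [Index.point, hp])
        rw [this]
        exact dvd_zero _)
      rwa [pow_one, ← sub_zero r.point, ← Int.cast_zero] at this
    have hchar : character r.point (.ofAdd t) = 1 := by
      change (expQZ (act r.point t)).toMul = 1
      rw [act_eq ht hdvd, zero_smul, map_zero, toMul_zero]
    rw [diagOp_basisVec, fourier_delta, hchar, Circle.coe_one, one_smul]
  have h2 : diagOp 1 (delta (.ofAdd t)) = 1 :=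
    (congrArg (piV 1) h1).trans (map_one (piV 1))
  have h3 := congrArg
    (fun T : EllTwo 1 →L[ℂ] EllTwo 1 => T (basisVec (Index.one 1)) (Index.one 1)) h2
  have h5 : (character 1 (.ofAdd t) : ℂ) = 1 := by
    simpa [diagOp_apply, fourier_delta, Index.point_one, basisVec] using h3
  have h6 : act 1 t = 0 := expQZ_eq_zero (by simpa [character] using Circle.coe_eq_one.1 h5)
  rw [act_eq ht (m := 1) (by simp), zsmul_mk_one_div_eq_zero_iff hpos] at h6
  exact p.2.one_lt.ne' (by exact_mod_cast Int.eq_one_of_dvd_one (by positivity) h6)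

/-! ### Unitary equivalence -/

/-- An intertwining unitary maps `e_1`, an eigenvector of `π_a` with character `a`, to an eigenvector
of `π_b` with the same character; so `a` is one of the points `s b`. -/
theorem sameOrbit_of_unitarilyEquivalent {a b : ZHat}
    (h : UnitarilyEquivalent (piV a) (piV b)) : SameOrbit a b := by
  obtain ⟨W, hW⟩ := h
  -- `W e_1` has a nonzero coordinate at some `s`, and it is an eigenvector of `π_b`
  have hne : W (basisVec (Index.one a)) ≠ 0 := by
    rw [Ne, LinearIsometryEquiv.map_eq_zero_iff]
    exact (orthonormal_basisVec a).ne_zero _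
  obtain ⟨s, hs⟩ : ∃ s, W (basisVec (Index.one a)) s ≠ 0 := by
    by_contra! h0
    exact hne (lp.ext (funext h0))
  have h1 : a = s.point := eq_of_character_eq fun r => by
    have h2 := hW (crossedAlg alpha (delta (.ofAdd r))) (basisVec (Index.one a))
    change W (diagOp a (delta (.ofAdd r)) _) = diagOp b (delta (.ofAdd r)) _ at h2
    rw [diagOp_basisVec, map_smul, Index.point_one] at h2
    have h3 := congrArg (fun ξ : EllTwo b => ξ s) h2
    simp only [lp.coeFn_smul, Pi.smul_apply, smul_eq_mul, diagOp_apply, fourier_delta] at h3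
    exact Circle.ext (mul_right_cancel₀ hs h3)
  refine ⟨s.1⁻¹, inv_pos.2 s.2.1, fun p => ?_⟩
  have h2 : (a p : ℚ_[(p : ℕ)]) = (s.1 : ℚ_[(p : ℕ)]) * (b p : ℚ_[(p : ℕ)]) :=
    congrArg Subtype.val (congrFun h1 p)
  have h3 : (s.1 : ℚ_[(p : ℕ)]) ≠ 0 := by exact_mod_cast s.2.1.ne'
  rw [h2, Rat.cast_inv, inv_mul_cancel_left₀ h3]

/-- If `b = t a` then `r ↦ r / t` is a bijection of the index sets. -/
def Index.equivOfSameOrbit {a b : ZHat} {t : ℚ} (ht : 0 < t)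
    (h : ∀ p : Nat.Primes, (b p : ℚ_[(p : ℕ)]) = (t : ℚ_[(p : ℕ)]) * (a p : ℚ_[(p : ℕ)])) :
    Index a ≃ Index b where
  toFun r := ⟨r.1 / t, div_pos r.2.1 ht, fun p => by
    have ht' : (t : ℚ_[(p : ℕ)]) ≠ 0 := by exact_mod_cast ht.ne'
    rw [h p, Rat.cast_div, ← mul_assoc, div_mul_cancel₀ _ ht']
    exact r.2.2 p⟩
  invFun s := ⟨s.1 * t, mul_pos s.2.1 ht, fun p => by
    rw [Rat.cast_mul, mul_assoc, ← h p]
    exact s.2.2 p⟩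
  left_inv r := Subtype.ext (div_mul_cancel₀ _ ht.ne')
  right_inv s := Subtype.ext (mul_div_cancel_right₀ _ ht.ne')

theorem Index.point_equivOfSameOrbit {a b : ZHat} {t : ℚ} (ht : 0 < t)
    (h : ∀ p : Nat.Primes, (b p : ℚ_[(p : ℕ)]) = (t : ℚ_[(p : ℕ)]) * (a p : ℚ_[(p : ℕ)]))
    (r : Index a) : (Index.equivOfSameOrbit ht h r).point = r.point := by
  refine funext fun p => Subtype.ext ?_
  have ht' : (t : ℚ_[(p : ℕ)]) ≠ 0 := by exact_mod_cast ht.ne'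
  change ((r.1 / t : ℚ) : ℚ_[(p : ℕ)]) * (b p : ℚ_[(p : ℕ)]) = r.1 * (a p : ℚ_[(p : ℕ)])
  rw [h p, Rat.cast_div, ← mul_assoc, div_mul_cancel₀ _ ht']

theorem Index.equivOfSameOrbit_mul {a b : ZHat} {t : ℚ} (ht : 0 < t)
    (h : ∀ p : Nat.Primes, (b p : ℚ_[(p : ℕ)]) = (t : ℚ_[(p : ℕ)]) * (a p : ℚ_[(p : ℕ)]))
    (n : ℕ+) (r : Index a) :
    Index.equivOfSameOrbit ht h (r.mul n) = (Index.equivOfSameOrbit ht h r).mul n :=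
  Subtype.ext (mul_div_assoc _ _ _)

/-- A bijection of index sets induces a unitary operator which permutes the canonical bases. -/
theorem exists_unitary_basisVec {a b : ZHat} (e : Index a ≃ Index b) :
    ∃ W : EllTwo a ≃ₗᵢ[ℂ] EllTwo b, ∀ r, W (basisVec r) = basisVec (e r) := by
  have ho : Orthonormal ℂ fun r : Index a => basisVec (e r) :=
    (orthonormal_basisVec b).comp e e.injective
  have hs : (Submodule.span ℂ (Set.range fun r : Index a => basisVec (e r)))ᗮ = ⊥ := by
    refine (Submodule.eq_bot_iff _).2 fun ξ hξ => lp.ext (funext fun s => ?_)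
    have h1 := (Submodule.mem_orthogonal _ _).1 hξ (basisVec s)
      (Submodule.subset_span ⟨e.symm s, by simp⟩)
    rw [basisVec, lp.inner_single_left] at h1
    simpa using h1
  let B := HilbertBasis.mkOfOrthogonalEqBot ho hs
  refine ⟨B.repr.symm, fun r => ?_⟩
  refine (B.repr_symm_single r).trans ?_
  rw [HilbertBasis.coe_mkOfOrthogonalEqBot]

theorem unitarilyEquivalent_of_sameOrbit {a b : ZHat} (h : SameOrbit a b) :
    UnitarilyEquivalent (piV a) (piV b) := by
  obtain ⟨t, ht, hab⟩ := h
  obtain ⟨W, hW⟩ := exists_unitary_basisVec (Index.equivOfSameOrbit ht hab)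
  have hW' : ∀ {T : EllTwo a →L[ℂ] EllTwo a} {S : EllTwo b →L[ℂ] EllTwo b},
      (∀ r, W (T (basisVec r)) = S (W (basisVec r))) → ∀ ξ, W (T ξ) = S (W ξ) := by
    intro T S hTS ξ
    have h1 : T = (W.symm : EllTwo b →L[ℂ] EllTwo a) ∘L S ∘L (W : EllTwo a →L[ℂ] EllTwo b) :=
      ellTwo_ext fun r => W.injective (by simp [hTS])
    rw [h1]
    simp
  have hdiag : ∀ f ξ, W (diagOp a f ξ) = diagOp b f (W ξ) := fun f => hW' fun r => by
    rw [diagOp_basisVec, map_smul, hW, diagOp_basisVec, Index.point_equivOfSameOrbit]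
  have hisom : ∀ n ξ, W (isomOp a n ξ) = isomOp b n (W ξ) := fun n => hW' fun r => by
    rw [isomOp_basisVec, hW, hW, isomOp_basisVec, Index.equivOfSameOrbit_mul]
  -- `W` is unitary, so it intertwines the adjoints as well
  have hstar : ∀ n ξ, W (star (isomOp a n) ξ) = star (isomOp b n) (W ξ) := fun n ξ => by
    refine ext_inner_right ℂ fun η => ?_
    obtain ⟨ζ, rfl⟩ := W.surjective η
    change inner ℂ (W ((isomOp a n).adjoint ξ)) (W ζ) = inner ℂ ((isomOp b n).adjoint (W ξ)) (W ζ)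
    rw [W.inner_map_map, ContinuousLinearMap.adjoint_inner_left,
      ContinuousLinearMap.adjoint_inner_left, ← hisom, W.inner_map_map]
  refine ⟨W, fun T ξ => ?_⟩
  have hca : Continuous (piV a) := (covariantRep a).continuous_integrated
  have hcb : Continuous (piV b) := (covariantRep b).continuous_integrated
  let P : Submodule ℂ CQ :=
    { carrier := {T | W (piV a T ξ) = piV b T (W ξ)}
      add_mem' := fun {S T} hS hT => by
        simp only [Set.mem_ofPred_eq, map_add, add_apply] at *
        rw [hS, hT]
      zero_mem' := by simp
      smul_mem' := fun c T hT => by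
        simp only [Set.mem_ofPred_eq, map_smul, smul_apply] at *
        rw [hT] }
  have hP : P = ⊤ := eq_top_of_monomial_mem P
    (isClosed_eq (W.continuous.comp (hca.clm_apply continuous_const))
      (hcb.clm_apply continuous_const)) fun m f n => by
        change W (piV a (monomial alpha m f n) ξ) = piV b (monomial alpha m f n) (W ξ)
        rw [piV_monomial, piV_monomial]
        simp only [mul_apply_eq_comp, hstar, hdiag, hisom]
  exact (hP ▸ Submodule.mem_top : T ∈ P)

end

end BostConnes

theorem mainTheorem7 (a : BostConnes.ZHat) (ha : a ≠ 0) :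
    ((Function.Injective (BostConnes.piV a) ↔ a ∈ nonZeroDivisors BostConnes.ZHat) ∧
      (a ∈ nonZeroDivisors BostConnes.ZHat ↔ ∀ p : Nat.Primes, a p ≠ 0)) ∧
    ∀ b : BostConnes.ZHat, b ≠ 0 →
      (BostConnes.UnitarilyEquivalent (BostConnes.piV a) (BostConnes.piV b) ↔
        BostConnes.SameOrbit a b) := by
  refine ⟨⟨?_, BostConnes.mem_nonZeroDivisors_iff a⟩, fun b _ =>
    ⟨BostConnes.sameOrbit_of_unitarilyEquivalent, BostConnes.unitarilyEquivalent_of_sameOrbit⟩⟩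
  rw [BostConnes.mem_nonZeroDivisors_iff]
  exact ⟨BostConnes.ne_zero_of_piV_injective, BostConnes.piV_injective⟩
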